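/- Let $\mathbb T=(\mathbb R/\mathbb Z)^2$, $k^\perp=(-k_2,k_1)$, and let $$K(y)=\nabla^\perp\Delta^{-1}(y)=\frac1{2\pi}\sum_{k\in\mathbb Z^2\setminus\{0\}}\frac{k^\perp}{|k|^2}\,\sin(2\pi k\cdot y),\qquad y\in\mathbb T\setminus\{0\},$$ be the Biot–Savart kernel of $\mathbb T$, where the series, which does not converge absolutely, is understood as $\lim_{\varepsilon\downarrow0}\frac1{2\pi}\sum_{k\neq0}e^{-\varepsilon|k|^2}\frac{k^\perp}{|k|^2}\sin(2\pi k\cdot y)$. Let $\delta>0$, let $\chi_\delta\in C^\infty(\mathbb T)$ be supported in the $\delta$-neighbourhood of $0$ with $\chi_\delta(0)=1$, and set $K_\delta=(1-\chi_\delta)K$ on $\mathbb T\setminus\{0\}$ and $K_\delta(0)=0$. Assume that $K_\delta$ is smooth at $0$ (for instance, that $\chi_\delta=1$ in a neighbourhood of $0$). Let $N\ge1$, $\xi_1,\dots,\xi_N\in\mathbb R\setminus\{0\}$, and $v_i(x)=\sum_{j\ne i}\xi_jK_\delta(x_i-x_j)$ for $x\in\mathbb T^N$. Let $\tau=(\tau_i)_{i\ge1}$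 be i.i.d. non-negative random variables on a probability space $(\Omega,\mathbb P)$ with at most exponential tails, i.e. $\mathbb P(\tau_1>r)\le Ce^{-cr}$ for all $r\ge0$ and some $C,c>0$, and with $\mathbb E(\tau_1)=1$. Then: 1. The system $\dot x_i=v_i(x)$, $i=1,\dots,N$, has for every initial configuration in $\mathbb T^N$ a unique solution on $[0,\infty)$. Write $\Phi_t:\mathbb T^N\to\mathbb T^N$ for its flow. 2. For every integer $m\ge1$ and every realization of $\tau$, the split system $$\frac{d}{dt}x(t)=N\,\tau_{n+1}\,\bigl(0,\dots,0,v_j(x(t)),0,\dots,0\bigr),\qquad n=\lfloor Nmt\rfloor,\quad j\in\{1,\dots,N\},\ j\equiv n+1\ (\mathrm{mod}\ N),$$ in which at time $t$ only the $j$-th vortex moves, has for every initial configuration in $\mathbb T^N$ a unique continuous solution on $[0,\infty)$, where $\frac{d}{dt}$ is the right derivative. Write $\Psi^m_t:\mathbb T^N\to\mathbb T^N$ for its flow, the interpolated stochastic flow. 3. For every fixed $x=(x_1,\dots,x_N)\in\mathbb T^N$ with $x_i\ne x_j$ for all $i\neq j$, $\mathbb P$-almost surely, for all $t\in[0,1]$,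 $$\Psi^m_t(x)\to\Phi_t(x)\qquad\text{as } m\to\infty .$$ -/

import Mathlib

open MeasureTheory ProbabilityTheory Filter Topology Set

namespace PointVortex

noncomputable section

/-- The plane `ℝ²` with its Euclidean norm. -/
abbrev Plane : Type := EuclideanSpace ℝ (Fin 2)

/-- The two-dimensional flat torus `(ℝ/ℤ)²`. -/
abbrev Torus : Type := UnitAddTorus (Fin 2)

/-- Positions of `N` vortices, possibly coinciding. -/
abbrev Config (N : ℕ) : Type := Fin N → Torus

/-- The covering map `ℝ² → (ℝ/ℤ)²`. -/
def toTorus (p : Plane) : Torus := fun a => ((p a : ℝ) : UnitAddCircle)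

/-- The Euclidean distance from `y` to the origin of the torus; `‖y a‖` is the distance from
the coordinate `y a` to `0` in `ℝ/ℤ`. -/
def torusNorm (y : Torus) : ℝ := √(∑ a, ‖y a‖ ^ 2)

/-- `|k|²` for a lattice point `k`. -/
def normSq (k : Fin 2 → ℤ) : ℝ := (k 0 : ℝ) ^ 2 + (k 1 : ℝ) ^ 2

/-- `k^⊥ = (-k₂, k₁)`. -/
def perp (k : Fin 2 → ℤ) : Plane := !₂[-(k 1 : ℝ), (k 0 : ℝ)]

/-- The Fourier series `(1/2π) ∑_{k ≠ 0} (k^⊥ / |k|²) sin (2π k·y)` of `∇^⊥ Δ⁻¹`, with the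
convergence factor `exp (-ε |k|²)` inserted. Here `UnitAddTorus.mFourier k y` is
`exp (2π i k·y)`, and the term with `k = 0` vanishes because `perp 0 = 0`. -/
def biotSavartGauss (ε : ℝ) (y : Torus) : Plane :=
  (1 / (2 * Real.pi)) • ∑' k : Fin 2 → ℤ,
    (Real.exp (-ε * normSq k) * (UnitAddTorus.mFourier k y).im / normSq k) • perp k

/-- The Biot-Savart kernel `K = ∇^⊥ Δ⁻¹` of the torus away from the origin: the sum of its
Fourier series. That series does not converge absolutely and is summed through the convergence
factors `exp (-ε |k|²)`, `ε ↓ 0`. At the origin the formula gives `0`. -/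
def biotSavart (y : Torus) : Plane :=
  limUnder (𝓝[>] (0 : ℝ)) (fun ε => biotSavartGauss ε y)

/-- The cut-off kernel `(1 - χ) K`. -/
def cutoffKernel (χ : Torus → ℝ) (y : Torus) : Plane := (1 - χ y) • biotSavart y

/-- The velocity `v_i(x) = ∑_{j ≠ i} ξ_j κ(x_i - x_j)` of the `i`-th vortex. -/
def velocity {N : ℕ} (κ : Torus → Plane) (ξ : Fin N → ℝ) (i : Fin N) (x : Config N) : Plane :=
  ∑ j ∈ Finset.univ.erase i, ξ j • κ (x i - x j)

/-- `γ : [0,∞) → 𝕋^N` starts at `x` and solves `ẋ_i = v_i(x)`, `i = 1, …, N`. The time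
derivative is taken in a lift `X` of `γ` to `(ℝ²)^N` (one-sided at time `0`). Values of `γ` at
negative times play no role. -/
def IsVortexTrajectory {N : ℕ} (κ : Torus → Plane) (ξ : Fin N → ℝ) (x : Config N)
    (γ : ℝ → Config N) : Prop :=
  γ 0 = x ∧
  ∃ X : ℝ → Fin N → Plane,
    (∀ t, 0 ≤ t → ∀ i, γ t i = toTorus (X t i)) ∧
    ∀ t, 0 ≤ t → HasDerivWithinAt X (fun i => velocity κ ξ i (γ t)) (Ici 0) t

/-- The velocity field of the interpolated split dynamics at time `t`: with `n = ⌊N m t⌋`, only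
the vortex with label `n mod N` moves, with velocity `N τ_n v_{n mod N}`. Vortices and random
times are numbered from `0`. -/
def splitVelocity {N : ℕ} [NeZero N] (κ : Torus → Plane) (ξ : Fin N → ℝ) (m : ℕ) (τ : ℕ → ℝ)
    (t : ℝ) (x : Config N) : Fin N → Plane :=
  let n : ℕ := ⌊(N : ℝ) * m * t⌋₊
  let j : Fin N := Fin.ofNat N n
  Pi.single j (((N : ℝ) * τ n) • velocity κ ξ j x)

/-- `γ : [0,∞) → 𝕋^N` starts at `x` and solves the split dynamics: it is continuous, and its
right derivative is given by `splitVelocity` at all times. (The field is right-continuous and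
piecewise constant in `t`, with jumps at the multiples of `1/(N m)`.) -/
def IsSplitTrajectory {N : ℕ} [NeZero N] (κ : Torus → Plane) (ξ : Fin N → ℝ) (m : ℕ)
    (τ : ℕ → ℝ) (x : Config N) (γ : ℝ → Config N) : Prop :=
  γ 0 = x ∧
  ∃ X : ℝ → Fin N → Plane,
    (∀ t, 0 ≤ t → ∀ i, γ t i = toTorus (X t i)) ∧
    ContinuousOn X (Ici 0) ∧
    ∀ t, 0 ≤ t → HasDerivWithinAt X (splitVelocity κ ξ m τ t (γ t)) (Ici t) t

/-- `Φ_t` is the flow of the vortex system: through every configuration `y` the curve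
`t ↦ Φ_t(y)`, `t ≥ 0`, is the one and only solution that starts at `y`. -/
def IsVortexFlow {N : ℕ} (κ : Torus → Plane) (ξ : Fin N → ℝ)
    (Φ : ℝ → Config N → Config N) : Prop :=
  ∀ y, IsVortexTrajectory κ ξ y (fun t => Φ t y) ∧
    ∀ γ, IsVortexTrajectory κ ξ y γ → ∀ t, 0 ≤ t → γ t = Φ t y

/-- `Ψ_t` is the flow of the interpolated split dynamics with times `τ`: through every
configuration `y` the curve `t ↦ Ψ_t(y)`, `t ≥ 0`, is the one and only solution that starts
at `y`. -/
def IsSplitFlow {N : ℕ} [NeZero N] (κ : Torus → Plane) (ξ : Fin N → ℝ) (m : ℕ) (τ : ℕ → ℝ)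
    (Ψ : ℝ → Config N → Config N) : Prop :=
  ∀ y, IsSplitTrajectory κ ξ m τ y (fun t => Ψ t y) ∧
    ∀ γ, IsSplitTrajectory κ ξ m τ y γ → ∀ t, 0 ≤ t → γ t = Ψ t y

end

end PointVortex

open scoped NNReal

namespace PointVortex

noncomputable section

/-! Two facts carry the proof: the cut-off kernel is `C¹`, and an averaging estimate compares the
split dynamics with the full one for a fixed sequence of times.

Regularity. The `ε`-derivative of the Gaussian-regularized series with symbol `k₁ ^ i k₂ ^ j / |k|²`
loses the denominator and factors into two one-dimensional theta sums (`hasDerivAt_gaussSum`). Off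
the lattice some coordinate is not an integer. By Poisson summation and Cauchy's estimate the theta
sum there is `O(ε²)` (`exists_norm_thetaSum_le_sq`), while the other is at most `O(ε⁻²)`. So the
series is Lipschitz in `ε`, locally uniformly in space. The same holds for its first space
derivatives, and the limit is `C¹` (`contDiffAt_biotSavart`). With smoothness at the origin and
periodicity, the velocity fields lifted to the plane are bounded and globally Lipschitz. This gives
the flows.

Averaging. Let `Y` solve `Y' = ∑ F_j(Y)` and let `X` be driven by one field at a time with intensity
`a`. Let `D_j` be the accumulated intensity of `F_j` minus the elapsed time. In `Z = X - Y - ∑ D_j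
F_j(Y)` the oscillating terms cancel, up to terms controlled by `Z` and `sup |D_j|`. A Gronwall
argument with weight `∫ a`, which is bounded because it equals `∑ (D_j + t)`, gives `X - Y = O(sup
|D_j|)` (`norm_sub_le_of_intensities`). Almost surely the `D_j` tend to zero uniformly on `[0, 1]`,
by the strong law along each residue class modulo `N`. The exceptional null set depends neither on
`t` nor on the initial configuration. -/

/-! ### Theta sums on the circle: growth as `s → 0`, and decay off the integers -/

/-- The `k`-th term of `thetaSum`. -/
def thetaTerm (j : ℕ) (s : ℝ) (k : ℤ) (z : ℂ) : ℂ :=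
  (k : ℂ) ^ j * Complex.exp (-(s : ℂ) * (k : ℂ) ^ 2 + 2 * Real.pi * Complex.I * k * z)

/-- `∑ₖ k ^ j exp (-s k²) exp (2 π i k z)`: the heat kernel of the circle and its derivatives, up
to normalization. -/
def thetaSum (j : ℕ) (s : ℝ) (z : ℂ) : ℂ := ∑' k : ℤ, thetaTerm j s k z

lemma norm_thetaTerm (j : ℕ) (s : ℝ) (k : ℤ) (z : ℂ) :
    ‖thetaTerm j s k z‖ = |(k : ℝ)| ^ j * Real.exp (-s * k ^ 2 - 2 * Real.pi * k * z.im) := by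
  have h : (-(s : ℂ) * (k : ℂ) ^ 2 + 2 * Real.pi * Complex.I * k * z).re
      = -s * k ^ 2 - 2 * Real.pi * k * z.im := by
    have h1 : (-(s : ℂ) * (k : ℂ) ^ 2 + 2 * Real.pi * Complex.I * k * z) =
      ((-s * k ^ 2 : ℝ) : ℂ) + ((2 * Real.pi * k : ℝ) : ℂ) * (Complex.I * z) := by
      push_cast; ring
    rw [h1, Complex.add_re, Complex.ofReal_re, Complex.re_ofReal_mul, Complex.I_mul_re]
    ring
  rw [thetaTerm, norm_mul, norm_pow, Complex.norm_exp, h, Complex.norm_intCast]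

lemma norm_thetaTerm_real (j : ℕ) (s : ℝ) (k : ℤ) (u : ℝ) :
    ‖thetaTerm j s k u‖ = |(k : ℝ)| ^ j * Real.exp (-s * k ^ 2) := by
  simp [norm_thetaTerm]

/-- A majorant uniform on a horizontal strip, in the shape whose summability is known from the
two-variable Jacobi theta function. -/
lemma norm_thetaTerm_le (j : ℕ) (s : ℝ) (k : ℤ) {z : ℂ} {R : ℝ} (hz : |z.im| ≤ R) :
    ‖thetaTerm j s k z‖ ≤
      |(k : ℝ)| ^ j * Real.exp (-Real.pi * (s / Real.pi * k ^ 2 - 2 * R * |(k : ℝ)|)) := by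
  rw [norm_thetaTerm]
  gcongr
  have h1 : -Real.pi * (s / Real.pi * k ^ 2 - 2 * R * |(k : ℝ)|)
      = -s * k ^ 2 + 2 * Real.pi * (R * |(k : ℝ)|) := by
    field_simp; ring
  rw [h1]
  have h2 : -((k : ℝ) * z.im) ≤ R * |(k : ℝ)| := by
    calc -((k : ℝ) * z.im) ≤ |(k : ℝ) * z.im| := neg_le_abs _
      _ = |z.im| * |(k : ℝ)| := by rw [abs_mul, mul_comm]
      _ ≤ _ := by gcongr
  nlinarith [Real.pi_pos, mul_le_mul_of_nonneg_left h2 Real.pi_pos.le]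

lemma summable_theta_bound (j : ℕ) {s : ℝ} (hs : 0 < s) (R : ℝ) :
    Summable fun k : ℤ => |(k : ℝ)| ^ j *
      Real.exp (-Real.pi * (s / Real.pi * k ^ 2 - 2 * R * |(k : ℝ)|)) := by
  simpa using summable_pow_mul_jacobiTheta₂_term_bound R (div_pos hs Real.pi_pos) j

lemma summable_thetaTerm (j : ℕ) {s : ℝ} (hs : 0 < s) (z : ℂ) :
    Summable fun k : ℤ => ‖thetaTerm j s k z‖ :=
  .of_nonneg_of_le (fun _ => norm_nonneg _) (fun k => norm_thetaTerm_le j s k le_rfl)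
    (summable_theta_bound j hs |z.im|)

lemma summable_pow_mul_exp (j : ℕ) {s : ℝ} (hs : 0 < s) :
    Summable fun k : ℤ => |(k : ℝ)| ^ j * Real.exp (-s * k ^ 2) := by
  simpa [norm_thetaTerm] using summable_thetaTerm j hs 0

lemma hasDerivAt_thetaTerm (j : ℕ) (s : ℝ) (k : ℤ) (z : ℂ) :
    HasDerivAt (thetaTerm j s k) (2 * Real.pi * Complex.I * thetaTerm (j + 1) s k z) z := by
  have h1 : HasDerivAt (fun z : ℂ => -(s : ℂ) * (k : ℂ) ^ 2 + 2 * Real.pi * Complex.I * k * z)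
      (2 * Real.pi * Complex.I * k) z := by
    simpa using ((hasDerivAt_id z).const_mul (2 * Real.pi * Complex.I * k)).const_add
      (-(s : ℂ) * (k : ℂ) ^ 2)
  refine (h1.cexp.const_mul ((k : ℂ) ^ j)).congr_deriv ?_
  simp only [thetaTerm]; ring

lemma hasDerivAt_thetaSum (j : ℕ) {s : ℝ} (hs : 0 < s) (z : ℂ) :
    HasDerivAt (thetaSum j s) (2 * Real.pi * Complex.I * thetaSum (j + 1) s z) z := by
  set R := |z.im| + 1
  have hopen : IsOpen {w : ℂ | |w.im| < R} :=
    isOpen_lt (by fun_prop) continuous_const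
  have hconv : Convex ℝ {w : ℂ | |w.im| < R} := by
    have : {w : ℂ | |w.im| < R} = Complex.imLm ⁻¹' (Ioo (-R) R) := by
      ext w; simp [abs_lt]
    rw [this]
    exact (convex_Ioo _ _).linear_preimage _
  have hz : z ∈ {w : ℂ | |w.im| < R} := by simp [R]
  have := hasDerivAt_tsum_of_isPreconnected
    (g := fun k => thetaTerm j s k)
    (g' := fun k z => 2 * Real.pi * Complex.I * thetaTerm (j + 1) s k z)
    ((summable_theta_bound (j + 1) hs R).mul_left (2 * Real.pi)) hopen hconv.isPreconnected
    (fun k y _ => hasDerivAt_thetaTerm j s k y)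
    (fun k y hy => by
      rw [norm_mul]
      have : ‖(2 * Real.pi * Complex.I : ℂ)‖ = 2 * Real.pi := by
        simp [abs_of_pos Real.pi_pos]
      rw [this]
      gcongr
      exact norm_thetaTerm_le _ _ _ (le_of_lt hy)) hz
    (summable_thetaTerm j hs z).of_norm hz
  rw [tsum_mul_left] at this
  exact this

lemma exp_neg_le_factorial_div (n : ℕ) {x : ℝ} (hx : 0 < x) :
    Real.exp (-x) ≤ n.factorial / x ^ n := by
  have h := Real.pow_div_factorial_le_exp x hx.le n
  have h0 : (0 : ℝ) < n.factorial := by exact_mod_cast n.factorial_pos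
  rw [Real.exp_neg, inv_le_comm₀ (Real.exp_pos x) (by positivity), inv_div]
  exact h

/-- On the real line, the derivatives of the heat kernel grow at most polynomially as `s → 0`. -/
lemma exists_norm_thetaSum_le :
    ∃ C : ℝ, 0 ≤ C ∧ ∀ j ≤ 2, ∀ s ∈ Ioc (0 : ℝ) 1, ∀ u : ℝ, ‖thetaSum j s u‖ ≤ C / s ^ 2 := by
  -- At `k = 0` the quotient is `0` by convention; the second summand supplies the bound there.
  have hsum : Summable fun k : ℤ => 2 / (k : ℝ) ^ 2 + if k = 0 then 1 else 0 := by
    refine Summable.add ?_ ?_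
    · simpa [div_eq_mul_inv] using
        ((Real.summable_one_div_int_pow (p := 2)).2 one_lt_two).mul_left 2
    · exact summable_of_ne_finset_zero (s := {0}) (by simp +contextual)
  refine ⟨∑' k : ℤ, (2 / (k : ℝ) ^ 2 + if k = 0 then 1 else 0),
    tsum_nonneg fun k => by positivity, fun j hj s hs u => ?_⟩
  obtain ⟨hs0, hs1⟩ := hs
  rw [thetaSum, div_eq_mul_inv]
  refine tsum_of_norm_bounded (hsum.hasSum.mul_right _) fun k => ?_
  rw [norm_thetaTerm_real, ← div_eq_mul_inv, le_div_iff₀ (by positivity)]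
  by_cases hk : k = 0
  · subst hk
    have : (0 : ℝ) ^ j ≤ 1 := pow_le_one₀ le_rfl zero_le_one
    have h2 : s ^ 2 ≤ 1 := pow_le_one₀ hs0.le hs1
    simpa using mul_le_one₀ this (by positivity) h2
  · have hk1 : 1 ≤ |(k : ℝ)| := by exact_mod_cast Int.one_le_abs hk
    have hk0 : (k : ℝ) ≠ 0 := by exact_mod_cast hk
    have h1 : |(k : ℝ)| ^ j ≤ (k : ℝ) ^ 2 := by
      rw [← sq_abs (k : ℝ)]; exact pow_le_pow_right₀ hk1 hj
    have h2 : Real.exp (-(s * k ^ 2)) ≤ 2 / (s * k ^ 2) ^ 2 := exp_neg_le_factorial_div 2 (by positivity)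
    simp only [hk, if_false, add_zero]
    calc |(k : ℝ)| ^ j * Real.exp (-s * k ^ 2) * s ^ 2
        ≤ (k : ℝ) ^ 2 * (2 / (s * k ^ 2) ^ 2) * s ^ 2 := by rw [neg_mul]; gcongr
      _ = 2 / (k : ℝ) ^ 2 := by field_simp

/-- A point off the integers stays away from them, proportionally to the size of the integer. -/
lemma exists_le_abs_sub_int {u : ℝ} (hu : ∀ n : ℤ, u ≠ n) :
    ∃ d c : ℝ, 0 < d ∧ 0 < c ∧ ∀ n : ℤ, d ≤ |n - u| ∧ c * (1 + |(n : ℝ)|) ≤ |n - u| := by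
  obtain ⟨d, hd0, hd⟩ : ∃ d : ℝ, 0 < d ∧ ∀ n : ℤ, d ≤ |n - u| := by
    refine ⟨|u - round u|, abs_pos.2 (sub_ne_zero.2 (hu _)), fun n => ?_⟩
    rw [abs_sub_comm (n : ℝ)]
    exact round_le u n
  -- From `1 ≤ |n - u| / d` and `|n| ≤ |n - u| + |u|`, the sum `1 + |n|` is at most `(1 / d + 1 +
  -- |u| / d) |n - u|`.
  refine ⟨d, (1 / d + 1 + |u| / d)⁻¹, hd0, by positivity, fun n => ⟨hd n, ?_⟩⟩
  rw [inv_mul_le_iff₀ (by positivity)]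
  have h1 : |(n : ℝ)| ≤ |n - u| + |u| := by simpa using abs_add_le (n - u) u
  have h2 : 1 ≤ |n - u| / d := (one_le_div₀ hd0).2 (hd n)
  have h3 : |u| * 1 ≤ |u| * (|n - u| / d) := by gcongr
  calc 1 + |(n : ℝ)| ≤ |n - u| / d + (|n - u| + |u| * (|n - u| / d)) := by linarith
    _ = _ := by ring

/-- Off the integers the heat kernel of the circle vanishes as `s → 0`, locally uniformly in the
complex plane. -/
lemma exists_norm_thetaSum_zero_le {u : ℝ} (hu : ∀ n : ℤ, u ≠ n) :
    ∃ r C : ℝ, 0 < r ∧ 0 ≤ C ∧ ∀ s ∈ Ioc (0 : ℝ) 1, ∀ z ∈ Metric.closedBall (u : ℂ) r,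
      ‖thetaSum 0 s z‖ ≤ C * s ^ 2 := by
  obtain ⟨d, c, hd, hc, h⟩ := exists_le_abs_sub_int hu
  have hsum : Summable fun n : ℤ => Real.pi * (6 / (c ^ 2) ^ 3 * (1 / (1 + |(n : ℝ)|) ^ 2)) := by
    refine (Summable.mul_left _ ?_).mul_left _
    refine Summable.of_nonneg_of_le (fun n => by positivity) (fun n => ?_)
      (f := fun n : ℤ => 1 / (n : ℝ) ^ 2 + if n = 0 then 1 else 0)
      (((Real.summable_one_div_int_pow (p := 2)).2 one_lt_two).add
        (summable_of_ne_finset_zero (s := {0}) (by simp +contextual)))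
    by_cases hn : n = 0
    · simp [hn]
    · have : (n : ℝ) ≠ 0 := by exact_mod_cast hn
      simp only [hn, if_false, add_zero]
      rw [← sq_abs (n : ℝ)]
      have : 0 < |(n : ℝ)| := by positivity
      gcongr
      linarith
  -- Radius `d / 4` keeps `(n - Re z)² - (Im z)²` above `(9/16 - 1/16) |n - u|²`, so the Gaussians
  -- centred at the integers remain small on a complex disc.
  refine ⟨d / 4, ∑' n : ℤ, Real.pi * (6 / (c ^ 2) ^ 3 * (1 / (1 + |(n : ℝ)|) ^ 2)), by positivity,
    tsum_nonneg fun n => by positivity, fun s hs z hz => ?_⟩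
  obtain ⟨hs0, hs1⟩ := hs
  -- Poisson summation turns the series into narrow Gaussians `exp (-π² (n - z)² / s)`, each tiny
  -- when `z` is near a non-integer.
  have hpoisson : thetaSum 0 s z = 1 / ((s / Real.pi : ℝ) : ℂ) ^ (1 / 2 : ℂ) *
      ∑' n : ℤ, Complex.exp (-Real.pi / ((s / Real.pi : ℝ) : ℂ) * (n + Complex.I * (Complex.I * z)) ^ 2) := by
    rw [← Complex.tsum_exp_neg_quadratic (a := ((s / Real.pi : ℝ) : ℂ))
      (by simpa using div_pos hs0 Real.pi_pos)]
    refine tsum_congr fun n => ?_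
    rw [thetaTerm, pow_zero, one_mul]
    congr 1
    push_cast
    have : (Real.pi : ℂ) ≠ 0 := by exact_mod_cast Real.pi_ne_zero
    field_simp
  rw [hpoisson, ← tsum_mul_left]
  refine tsum_of_norm_bounded (hsum.hasSum.mul_right _) fun n => ?_
  -- Replacing the power `1/2` by `1` is harmless: the factor `s ^ 3` gained from the exponential
  -- leaves `s ^ 2`.
  have hfac : ‖1 / ((s / Real.pi : ℝ) : ℂ) ^ (1 / 2 : ℂ)‖ ≤ Real.pi / s := by
    have hpos : 0 < s / Real.pi := div_pos hs0 Real.pi_pos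
    rw [norm_div, norm_one, Complex.norm_cpow_eq_rpow_re_of_pos hpos]
    have : s / Real.pi ≤ (s / Real.pi) ^ ((1 / 2 : ℂ).re) := by
      refine Real.self_le_rpow_of_le_one hpos.le ?_ (by norm_num)
      rw [div_le_one Real.pi_pos]
      linarith [Real.pi_gt_three]
    calc _ ≤ 1 / (s / Real.pi) := by gcongr
      _ = _ := by rw [one_div_div]
  have hre : |z.re - u| ≤ d / 4 := by
    have := Complex.abs_re_le_norm (z - u)
    rw [mem_closedBall_iff_norm] at hz
    simpa using this.trans hz
  have him : |z.im| ≤ d / 4 := by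
    have := Complex.abs_im_le_norm (z - u)
    rw [mem_closedBall_iff_norm] at hz
    simpa using this.trans hz
  have hq : (c * (1 + |(n : ℝ)|)) ^ 2 / 9 ≤ (n - z.re) ^ 2 - z.im ^ 2 := by
    obtain ⟨h1, h2⟩ := h n
    have h3 : |n - u| ≤ |n - z.re| + |z.re - u| := by
      simpa using abs_add_le (n - z.re) (z.re - u)
    have h4 : 3 / 4 * |n - u| ≤ |n - z.re| := by linarith
    have h5 : |z.im| ≤ 1 / 4 * |n - u| := by linarith
    have h6 : (3 / 4 * |n - u|) ^ 2 ≤ (n - z.re) ^ 2 := by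
      rw [← sq_abs (n - z.re)]; gcongr
    have h7 : z.im ^ 2 ≤ (1 / 4 * |n - u|) ^ 2 := by
      rw [← sq_abs z.im]; gcongr
    have h8 : (c * (1 + |(n : ℝ)|)) ^ 2 ≤ |n - u| ^ 2 := by gcongr
    nlinarith
  have hexp : ‖Complex.exp (-Real.pi / ((s / Real.pi : ℝ) : ℂ) *
      (n + Complex.I * (Complex.I * z)) ^ 2)‖ ≤ 6 / (c ^ 2) ^ 3 * (1 / (1 + |(n : ℝ)|) ^ 2) * s ^ 3 := by
    have h1 : (-Real.pi / ((s / Real.pi : ℝ) : ℂ) * (n + Complex.I * (Complex.I * z)) ^ 2).re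
        = -(Real.pi ^ 2 / s * ((n - z.re) ^ 2 - z.im ^ 2)) := by
      have h2 : -Real.pi / ((s / Real.pi : ℝ) : ℂ) = ((-(Real.pi ^ 2 / s) : ℝ) : ℂ) := by
        push_cast
        have : (Real.pi : ℂ) ≠ 0 := by exact_mod_cast Real.pi_ne_zero
        field_simp
      have h3 : (n : ℂ) + Complex.I * (Complex.I * z) = n - z := by
        rw [← mul_assoc, Complex.I_mul_I]; ring
      rw [h2, h3, Complex.re_ofReal_mul, pow_two ((n : ℂ) - z), Complex.mul_re]
      simp only [Complex.sub_re, Complex.intCast_re, Complex.sub_im, Complex.intCast_im]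
      ring
    rw [Complex.norm_exp, h1]
    set a := (c * (1 + |(n : ℝ)|)) ^ 2 / s with ha
    have ha0 : 0 < a := by positivity
    have h2 : a ≤ Real.pi ^ 2 / s * ((n - z.re) ^ 2 - z.im ^ 2) := by
      -- This absorbs the factor `1 / 9` of `hq`.
      have h9 : 9 ≤ Real.pi ^ 2 := by nlinarith [Real.pi_gt_three]
      calc a = 9 / s * ((c * (1 + |(n : ℝ)|)) ^ 2 / 9) := by rw [ha]; ring
        _ ≤ Real.pi ^ 2 / s * ((c * (1 + |(n : ℝ)|)) ^ 2 / 9) := by gcongr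
        _ ≤ _ := by gcongr
    calc Real.exp (-(Real.pi ^ 2 / s * ((n - z.re) ^ 2 - z.im ^ 2))) ≤ Real.exp (-a) := by gcongr
      _ ≤ 6 / a ^ 3 := by simpa [Nat.factorial] using exp_neg_le_factorial_div 3 ha0
      _ = 6 / (c ^ 2) ^ 3 * (1 / (1 + |(n : ℝ)|) ^ 6) * s ^ 3 := by rw [ha]; field_simp
      _ ≤ _ := by
        gcongr
        · linarith [abs_nonneg (n : ℝ)]
        · norm_num
  calc _ = ‖1 / ((s / Real.pi : ℝ) : ℂ) ^ (1 / 2 : ℂ)‖ * _ := norm_mul _ _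
    _ ≤ Real.pi / s * (6 / (c ^ 2) ^ 3 * (1 / (1 + |(n : ℝ)|) ^ 2) * s ^ 3) := by gcongr
    _ = _ := by field_simp

/-- Off the integers all derivatives of the heat kernel vanish as `s → 0`. -/
lemma exists_norm_thetaSum_le_sq {u : ℝ} (hu : ∀ n : ℤ, u ≠ n) (j : ℕ) :
    ∃ r C : ℝ, 0 < r ∧ 0 ≤ C ∧ ∀ s ∈ Ioc (0 : ℝ) 1, ∀ z ∈ Metric.closedBall (u : ℂ) r,
      ‖thetaSum j s z‖ ≤ C * s ^ 2 := by
  induction j with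
  | zero => exact exists_norm_thetaSum_zero_le hu
  | succ j ih =>
    obtain ⟨r, C, hr, hC, h⟩ := ih
    refine ⟨r / 2, C / (r / 2), by positivity, by positivity, fun s hs z hz => ?_⟩
    have hderiv : Differentiable ℂ (thetaSum j s) := fun w =>
      (hasDerivAt_thetaSum j hs.1 w).differentiableAt
    -- Cauchy's estimate on circles of radius `r / 2` costs no power of `s`; it is the reason for
    -- working on complex discs.
    have hcauchy := Complex.norm_deriv_le_of_forall_mem_sphere_norm_le (c := z) (half_pos hr)
      hderiv.diffContOnCl (C := C * s ^ 2) fun w hw => h s hs w (by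
        rw [Metric.mem_closedBall] at hz ⊢
        rw [Metric.mem_sphere] at hw
        linarith [dist_triangle w z u])
    rw [(hasDerivAt_thetaSum j hs.1 z).deriv, norm_mul] at hcauchy
    have h1 : 1 ≤ ‖(2 * Real.pi * Complex.I : ℂ)‖ := by
      simp [abs_of_pos Real.pi_pos]
      linarith [Real.pi_gt_three]
    calc ‖thetaSum (j + 1) s z‖ = 1 * ‖thetaSum (j + 1) s z‖ := (one_mul _).symm
      _ ≤ ‖(2 * Real.pi * Complex.I : ℂ)‖ * ‖thetaSum (j + 1) s z‖ := by gcongr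
      _ ≤ C * s ^ 2 / (r / 2) := hcauchy
      _ = _ := by ring

/-! ### The regularized Fourier series and its derivatives in space and in `ε` -/

/-- The coefficient `k₁ ^ i k₂ ^ j exp (-ε |k|²) / |k|²`. -/
def gaussCoeff (i j : ℕ) (ε : ℝ) (k : Fin 2 → ℤ) : ℝ :=
  (k 0 : ℝ) ^ i * (k 1 : ℝ) ^ j / normSq k * Real.exp (-ε * normSq k)

/-- The plane wave `exp (2 π i k·p)`. -/
def planeWave (k : Fin 2 → ℤ) (p : Plane) : ℂ :=
  Complex.exp (((2 * Real.pi * (k 0 * p 0 + k 1 * p 1) : ℝ) : ℂ) * Complex.I)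

/-- The regularized Fourier series with symbol `k₁ ^ i k₂ ^ j / |k|²`. -/
def gaussSum (i j : ℕ) (ε : ℝ) (p : Plane) : ℂ :=
  ∑' k : Fin 2 → ℤ, (gaussCoeff i j ε k : ℂ) * planeWave k p

lemma norm_planeWave (k : Fin 2 → ℤ) (p : Plane) : ‖planeWave k p‖ = 1 :=
  Complex.norm_exp_ofReal_mul_I _

lemma normSq_nonneg (k : Fin 2 → ℤ) : 0 ≤ normSq k := by unfold normSq; positivity

lemma normSq_eq_zero_or_one_le (k : Fin 2 → ℤ) : k = 0 ∨ 1 ≤ normSq k := by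
  by_cases h : k = 0
  · exact .inl h
  · right
    obtain ⟨a, ha⟩ := Function.ne_iff.1 h
    have h1 : (1 : ℝ) ≤ (k a : ℝ) ^ 2 := by
      exact_mod_cast Int.one_le_abs (pow_ne_zero 2 ha) |>.trans_eq (abs_of_nonneg (sq_nonneg _))
    unfold normSq
    fin_cases a
    · exact h1.trans (le_add_of_nonneg_right (sq_nonneg _))
    · exact h1.trans (le_add_of_nonneg_left (sq_nonneg _))

lemma normSq_zero : normSq 0 = 0 := by simp [normSq]

/-- Off the origin `|k|² ≥ 1`, so the denominator can be dropped and the rest factors; at `k = 0`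
division by zero makes the coefficient vanish. -/
lemma abs_gaussCoeff_le (i j : ℕ) (ε : ℝ) (k : Fin 2 → ℤ) :
    |gaussCoeff i j ε k| ≤
      (|(k 0 : ℝ)| ^ i * Real.exp (-ε * k 0 ^ 2)) * (|(k 1 : ℝ)| ^ j * Real.exp (-ε * k 1 ^ 2)) := by
  have h1 : |gaussCoeff i j ε k| =
      (|(k 0 : ℝ)| ^ i * |(k 1 : ℝ)| ^ j) * Real.exp (-ε * normSq k) / normSq k := by
    rw [gaussCoeff, abs_mul, abs_div, abs_mul, abs_pow, abs_pow, Real.abs_exp,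
      abs_of_nonneg (normSq_nonneg k)]
    ring
  have h2 : (|(k 0 : ℝ)| ^ i * Real.exp (-ε * k 0 ^ 2)) * (|(k 1 : ℝ)| ^ j * Real.exp (-ε * k 1 ^ 2))
      = (|(k 0 : ℝ)| ^ i * |(k 1 : ℝ)| ^ j) * Real.exp (-ε * normSq k) := by
    rw [normSq, mul_add, Real.exp_add]; ring
  rw [h1, h2]
  rcases normSq_eq_zero_or_one_le k with rfl | h
  · rw [normSq_zero, div_zero]; positivity
  · exact div_le_self (by positivity) h

lemma summable_fin_two_mul {f g : ℤ → ℝ} (hf : Summable f) (hg : Summable g)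
    (hf0 : 0 ≤ f) (hg0 : 0 ≤ g) : Summable fun k : Fin 2 → ℤ => f (k 0) * g (k 1) :=
  (finTwoArrowEquiv ℤ).summable_iff.2 (hf.mul_of_nonneg hg hf0 hg0)

lemma summable_gauss_bound (i j : ℕ) {ε : ℝ} (hε : 0 < ε) :
    Summable fun k : Fin 2 → ℤ => (|(k 0 : ℝ)| ^ i * Real.exp (-ε * k 0 ^ 2)) *
      (|(k 1 : ℝ)| ^ j * Real.exp (-ε * k 1 ^ 2)) :=
  summable_fin_two_mul (summable_pow_mul_exp i hε) (summable_pow_mul_exp j hε)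
    (fun _ => by simp only [Pi.zero_apply]; positivity)
    (fun _ => by simp only [Pi.zero_apply]; positivity)

lemma summable_abs_gaussCoeff (i j : ℕ) {ε : ℝ} (hε : 0 < ε) :
    Summable fun k => |gaussCoeff i j ε k| :=
  .of_nonneg_of_le (fun _ => abs_nonneg _) (abs_gaussCoeff_le i j ε) (summable_gauss_bound i j hε)

lemma norm_gaussTerm (i j : ℕ) (ε : ℝ) (k : Fin 2 → ℤ) (p : Plane) :
    ‖(gaussCoeff i j ε k : ℂ) * planeWave k p‖ = |gaussCoeff i j ε k| := by
  rw [norm_mul, norm_planeWave, mul_one, Complex.norm_real, Real.norm_eq_abs]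

lemma summable_gaussTerm (i j : ℕ) {ε : ℝ} (hε : 0 < ε) (p : Plane) :
    Summable fun k : Fin 2 → ℤ => (gaussCoeff i j ε k : ℂ) * planeWave k p :=
  .of_norm (by simpa only [norm_gaussTerm] using summable_abs_gaussCoeff i j hε)

/-- The coordinate `p a` as a complex-valued linear form. -/
def coordForm (a : Fin 2) : Plane →L[ℝ] ℂ := Complex.ofRealCLM ∘L EuclideanSpace.proj a

lemma coordForm_apply (a : Fin 2) (p : Plane) : coordForm a p = (p a : ℂ) := rfl

lemma hasFDerivAt_planeWave (k : Fin 2 → ℤ) (p : Plane) :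
    HasFDerivAt (planeWave k)
      ((2 * Real.pi * Complex.I * planeWave k p) •
        ((k 0 : ℂ) • coordForm 0 + (k 1 : ℂ) • coordForm 1)) p := by
  have h : HasFDerivAt (fun q : Plane => (2 * Real.pi * Complex.I) *
      (((k 0 : ℂ) • coordForm 0 + (k 1 : ℂ) • coordForm 1) q))
      ((2 * Real.pi * Complex.I : ℂ) • ((k 0 : ℂ) • coordForm 0 + (k 1 : ℂ) • coordForm 1)) p :=
    (ContinuousLinearMap.hasFDerivAt _).const_mul _
  have h2 := h.cexp
  have h3 : (fun q : Plane => Complex.exp ((2 * Real.pi * Complex.I) *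
      (((k 0 : ℂ) • coordForm 0 + (k 1 : ℂ) • coordForm 1) q))) = planeWave k := by
    funext q
    rw [planeWave]
    congr 1
    simp only [add_apply, smul_apply, coordForm_apply,
      smul_eq_mul]
    push_cast; ring
  rw [h3] at h2
  refine h2.congr_fderiv ?_
  rw [show Complex.exp ((2 * Real.pi * Complex.I) *
      (((k 0 : ℂ) • coordForm 0 + (k 1 : ℂ) • coordForm 1) p)) = planeWave k p from congrFun h3 p,
    smul_smul, mul_comm]

lemma gaussCoeff_succ_left (i j : ℕ) (ε : ℝ) (k : Fin 2 → ℤ) :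
    gaussCoeff (i + 1) j ε k = gaussCoeff i j ε k * k 0 := by
  simp only [gaussCoeff]; ring

lemma gaussCoeff_succ_right (i j : ℕ) (ε : ℝ) (k : Fin 2 → ℤ) :
    gaussCoeff i (j + 1) ε k = gaussCoeff i j ε k * k 1 := by
  simp only [gaussCoeff]; ring

/-- The derivative of `gaussSum i j` with respect to the space variable, as a function of its two
partial derivatives. -/
def gradForm (a b : ℂ) : Plane →L[ℝ] ℂ :=
  (2 * Real.pi * Complex.I * a) • coordForm 0 + (2 * Real.pi * Complex.I * b) • coordForm 1

/-- A space derivative raises one exponent, so the family `gaussSum` is closed under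
differentiation. The majorant is independent of `p` since plane waves have modulus one. -/
lemma hasFDerivAt_gaussSum (i j : ℕ) {ε : ℝ} (hε : 0 < ε) (p : Plane) :
    HasFDerivAt (gaussSum i j ε) (gradForm (gaussSum (i + 1) j ε p) (gaussSum i (j + 1) ε p)) p := by
  have hsum0 := summable_gaussTerm (i + 1) j hε p
  have hsum1 := summable_gaussTerm i (j + 1) hε p
  have hbound := ((summable_abs_gaussCoeff (i + 1) j hε).mul_left (2 * Real.pi)).mul_right
    ‖coordForm 0‖ |>.add <| ((summable_abs_gaussCoeff i (j + 1) hε).mul_left (2 * Real.pi)).mul_right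
    ‖coordForm 1‖
  have hpi : ‖(2 * Real.pi * Complex.I : ℂ)‖ = 2 * Real.pi := by simp [abs_of_pos Real.pi_pos]
  have := hasFDerivAt_tsum (𝕜 := ℝ) (f := fun k q => (gaussCoeff i j ε k : ℂ) * planeWave k q)
    (f' := fun k q => gradForm ((gaussCoeff (i + 1) j ε k : ℂ) * planeWave k q)
      ((gaussCoeff i (j + 1) ε k : ℂ) * planeWave k q)) (x₀ := p) hbound
    (fun k q => by
      refine ((hasFDerivAt_planeWave k q).const_mul _).congr_fderiv ?_
      ext v
      simp only [gradForm, gaussCoeff_succ_left, gaussCoeff_succ_right,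
        add_apply, smul_apply, smul_eq_mul]
      push_cast; ring)
    (fun k q => by
      refine (norm_add_le _ _).trans (add_le_add ?_ ?_) <;>
      · rw [norm_smul, norm_mul, hpi, norm_gaussTerm])
    (summable_gaussTerm i j hε p) p
  refine this.congr_fderiv ?_
  exact (((hsum0.hasSum.mul_left _).smul_const (coordForm 0)).add
    ((hsum1.hasSum.mul_left _).smul_const (coordForm 1))).tsum_eq

/-- The factor `-|k|²` cancels the denominator, and the double sum separates. The condition `i + j ≠
0` concerns `k = 0`, absent on the left by the division convention, hence needing `0 ^ i * 0 ^ j =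
0` on the right. -/
lemma hasDerivAt_gaussSum (i j : ℕ) (hij : i + j ≠ 0) {ε : ℝ} (hε : 0 < ε) (p : Plane) :
    HasDerivAt (fun ε => gaussSum i j ε p)
      (-(thetaSum i ε (p 0) * thetaSum j ε (p 1))) ε := by
  have hcoeff : ∀ (k : Fin 2 → ℤ) (ε' : ℝ), HasDerivAt (fun ε => gaussCoeff i j ε k)
      (-((k 0 : ℝ) ^ i * (k 1 : ℝ) ^ j * Real.exp (-ε' * normSq k))) ε' := by
    intro k ε'
    have h1 : HasDerivAt (fun ε : ℝ => -ε * normSq k) (-normSq k) ε' := by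
      simpa using (hasDerivAt_id ε').neg.mul_const (normSq k)
    refine (h1.exp.const_mul _).congr_deriv ?_
    rcases normSq_eq_zero_or_one_le k with rfl | h
    · have : (0 : ℝ) ^ i * (0 : ℝ) ^ j = 0 := by rw [← pow_add, zero_pow hij]
      simp [this]
    · have : normSq k ≠ 0 := by positivity
      field_simp
  have hsplit : ∀ (k : Fin 2 → ℤ) (ε' : ℝ),
      ((k 0 : ℝ) ^ i * (k 1 : ℝ) ^ j * Real.exp (-ε' * normSq k) : ℝ) * planeWave k p =
      thetaTerm i ε' (k 0) (p 0) * thetaTerm j ε' (k 1) (p 1) := by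
    intro k ε'
    rw [thetaTerm, thetaTerm, planeWave, normSq]
    push_cast
    rw [mul_assoc, ← Complex.exp_add, mul_mul_mul_comm, ← Complex.exp_add]
    congr 2
    ring
  have := hasDerivAt_tsum_of_isPreconnected (𝕜 := ℝ) (t := Ioi (ε / 2)) (y := ε) (y₀ := ε)
    (g := fun k ε => (gaussCoeff i j ε k : ℂ) * planeWave k p)
    (g' := fun k ε => -(thetaTerm i ε (k 0) (p 0) * thetaTerm j ε (k 1) (p 1)))
    (summable_gauss_bound i j (half_pos hε)) isOpen_Ioi isPreconnected_Ioi
    (fun k ε' _ => by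
      refine ((hcoeff k ε').ofReal_comp.mul_const _).congr_deriv ?_
      rw [← hsplit]; push_cast; ring)
    (fun k ε' hε' => by
      rw [norm_neg, norm_mul, norm_thetaTerm_real, norm_thetaTerm_real]
      have : ε / 2 ≤ ε' := le_of_lt hε'
      gcongr)
    (half_lt_self hε) (summable_gaussTerm i j hε p) (half_lt_self hε)
  refine this.congr_deriv ?_
  rw [tsum_neg, thetaSum, thetaSum, tsum_mul_tsum_of_summable_norm (summable_thetaTerm i hε _)
    (summable_thetaTerm j hε _)]
  congr 1
  exact (finTwoArrowEquiv ℤ).tsum_eq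
    (fun x : ℤ × ℤ => thetaTerm i ε x.1 (p 0) * thetaTerm j ε x.2 (p 1))

lemma toTorus_eq_zero_iff (p : Plane) : toTorus p = 0 ↔ ∀ a, ∃ n : ℤ, p a = n := by
  simp only [funext_iff, toTorus, Pi.zero_apply, AddCircle.coe_eq_zero_iff]
  simp [eq_comm]

lemma continuous_toTorus : Continuous toTorus := by
  unfold toTorus
  refine continuous_pi fun a => ?_
  exact (AddCircle.continuous_mk' (1 : ℝ)).comp (by fun_prop)

lemma abs_coord_sub_le (p q : Plane) (a : Fin 2) : |p a - q a| ≤ ‖p - q‖ := by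
  simpa using PiLp.norm_apply_le (p - q) a

/-- Some coordinate of `p₀` is not an integer; its `O(ε²)` decay compensates the `O(ε⁻²)` growth
allowed in the other coordinate. -/
lemma exists_norm_theta_mul_theta_le {p₀ : Plane} (hp : toTorus p₀ ≠ 0) {i j : ℕ} (hi : i ≤ 2)
    (hj : j ≤ 2) : ∃ r C : ℝ, 0 < r ∧ 0 ≤ C ∧ ∀ p ∈ Metric.ball p₀ r, ∀ ε ∈ Ioc (0 : ℝ) 1,
      ‖thetaSum i ε (p 0) * thetaSum j ε (p 1)‖ ≤ C := by
  obtain ⟨B, hB0, hB⟩ := exists_norm_thetaSum_le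
  have key : ∀ (a : Fin 2), (∀ n : ℤ, p₀ a ≠ n) → ∀ l m, m ≤ 2 → ∃ r C : ℝ, 0 < r ∧ 0 ≤ C ∧
      ∀ p ∈ Metric.ball p₀ r, ∀ ε ∈ Ioc (0 : ℝ) 1, ∀ u : ℝ,
        ‖thetaSum l ε (p a)‖ * ‖thetaSum m ε u‖ ≤ C := by
    intro a ha l m hm
    obtain ⟨r, C, hr, hC, h⟩ := exists_norm_thetaSum_le_sq ha l
    refine ⟨r, C * B, hr, by positivity, fun p hpr ε hε u => ?_⟩
    have hmem : ((p a : ℝ) : ℂ) ∈ Metric.closedBall ((p₀ a : ℝ) : ℂ) r := by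
      rw [mem_closedBall_iff_norm, ← Complex.ofReal_sub, Complex.norm_real, Real.norm_eq_abs]
      exact (abs_coord_sub_le _ _ _).trans (mem_ball_iff_norm.1 hpr).le
    have hε0 := hε.1
    calc ‖thetaSum l ε (p a)‖ * ‖thetaSum m ε u‖ ≤ (C * ε ^ 2) * (B / ε ^ 2) := by
          gcongr
          · exact h ε hε _ hmem
          · exact hB m hm ε hε u
      _ = C * B := by field_simp
  rw [Ne, toTorus_eq_zero_iff] at hp
  push Not at hp
  obtain ⟨a, ha⟩ := hp
  match a, ha with
  | 0, ha =>
    obtain ⟨r, C, hr, hC, h⟩ := key 0 ha i j hj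
    exact ⟨r, C, hr, hC, fun p hpr ε hε => by rw [norm_mul]; exact h p hpr ε hε _⟩
  | 1, ha =>
    obtain ⟨r, C, hr, hC, h⟩ := key 1 ha j i hi
    exact ⟨r, C, hr, hC, fun p hpr ε hε => by rw [norm_mul, mul_comm]; exact h p hpr ε hε _⟩

/-! ### The limit `ε → 0` and its differentiability off the lattice -/

/-- A Lipschitz function on `(0, 1]` has a limit at `0`, attained at a linear rate. -/
lemma tendsto_limUnder_of_lipschitz {E : Type*} [NormedAddCommGroup E] [CompleteSpace E]
    {f : ℝ → E} {C : ℝ} (hC : 0 ≤ C)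
    (hf : ∀ s ∈ Ioc (0 : ℝ) 1, ∀ t ∈ Ioc (0 : ℝ) 1, ‖f s - f t‖ ≤ C * |s - t|) :
    Tendsto f (𝓝[>] 0) (𝓝 (limUnder (𝓝[>] 0) f)) ∧
      ∀ s ∈ Ioc (0 : ℝ) 1, ‖f s - limUnder (𝓝[>] 0) f‖ ≤ C * s := by
  have hcauchy : Cauchy (map f (𝓝[>] (0 : ℝ))) := by
    rw [Metric.cauchy_iff]
    refine ⟨inferInstance, fun e he => ?_⟩
    set δ := min 1 (e / (C + 1)) with hδ
    have hδ0 : 0 < δ := by positivity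
    refine ⟨f '' Ioc 0 δ, image_mem_map (Ioc_mem_nhdsGT hδ0), ?_⟩
    rintro _ ⟨s, hs, rfl⟩ _ ⟨t, ht, rfl⟩
    have hδ1 : δ ≤ 1 := min_le_left _ _
    have hst : |s - t| ≤ δ := by
      rw [abs_le]; constructor <;> linarith [hs.1, hs.2, ht.1, ht.2]
    rw [dist_eq_norm]
    calc ‖f s - f t‖ ≤ C * |s - t| :=
          hf s ⟨hs.1, hs.2.trans hδ1⟩ t ⟨ht.1, ht.2.trans hδ1⟩
      _ ≤ C * δ := by gcongr
      _ < (C + 1) * δ := by linarith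
      _ ≤ (C + 1) * (e / (C + 1)) := by gcongr; exact min_le_right _ _
      _ = e := by field_simp
  have hlim : Tendsto f (𝓝[>] 0) (𝓝 (limUnder (𝓝[>] 0) f)) :=
    tendsto_nhds_limUnder (CompleteSpace.complete hcauchy)
  refine ⟨hlim, fun s hs => ?_⟩
  have h1 : Tendsto (fun t => ‖f s - f t‖) (𝓝[>] 0) (𝓝 ‖f s - limUnder (𝓝[>] 0) f‖) :=
    (tendsto_const_nhds.sub hlim).norm
  refine le_of_tendsto h1 ?_
  filter_upwards [Ioc_mem_nhdsGT hs.1] with t ht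
  refine (hf s hs t ⟨ht.1, ht.2.trans hs.2⟩).trans ?_
  gcongr
  rw [abs_le]; constructor <;> linarith [ht.1, ht.2]

/-- The limit `ε → 0` of `gaussSum`. -/
def gaussLimit (i j : ℕ) (p : Plane) : ℂ := limUnder (𝓝[>] (0 : ℝ)) fun ε => gaussSum i j ε p

/-- The mean value inequality in `ε`, with a derivative bound uniform over the ball. -/
lemma exists_gaussLimit_rate {p₀ : Plane} (hp : toTorus p₀ ≠ 0) {i j : ℕ} (hij : i + j ≠ 0)
    (hi : i ≤ 2) (hj : j ≤ 2) : ∃ r C : ℝ, 0 < r ∧ 0 ≤ C ∧ ∀ p ∈ Metric.ball p₀ r,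
      Tendsto (fun ε => gaussSum i j ε p) (𝓝[>] 0) (𝓝 (gaussLimit i j p)) ∧
      ∀ ε ∈ Ioc (0 : ℝ) 1, ‖gaussSum i j ε p - gaussLimit i j p‖ ≤ C * ε := by
  obtain ⟨r, C, hr, hC, h⟩ := exists_norm_theta_mul_theta_le hp hi hj
  refine ⟨r, C, hr, hC, fun p hpr => tendsto_limUnder_of_lipschitz hC fun s hs t ht => ?_⟩
  exact (convex_Ioc (0 : ℝ) 1).norm_image_sub_le_of_norm_hasDerivWithin_le
    (fun ε hε => (hasDerivAt_gaussSum i j hij hε.1 p).hasDerivWithinAt)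
    (fun ε hε => by rw [norm_neg]; exact h p hpr ε hε) ht hs

/-- The values of the regularization parameter along which limits are taken. -/
def epsSeq (n : ℕ) : ℝ := 1 / ((n : ℝ) + 1)

lemma epsSeq_mem (n : ℕ) : epsSeq n ∈ Ioc (0 : ℝ) 1 := by
  refine ⟨by unfold epsSeq; positivity, ?_⟩
  unfold epsSeq
  exact div_le_one_of_le₀ (by simp) (by positivity)

lemma tendsto_epsSeq : Tendsto epsSeq atTop (𝓝 0) := tendsto_one_div_add_atTop_nhds_zero_nat

lemma tendsto_epsSeq_nhdsGT : Tendsto epsSeq atTop (𝓝[>] 0) :=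
  tendsto_nhdsWithin_iff.2 ⟨tendsto_epsSeq, .of_forall fun n => (epsSeq_mem n).1⟩

lemma tendstoUniformlyOn_of_le_mul_eps {α E : Type*} [NormedAddCommGroup E] {f : ℕ → α → E}
    {g : α → E} {s : Set α} {C : ℝ} (h : ∀ n, ∀ x ∈ s, ‖f n x - g x‖ ≤ C * epsSeq n) :
    TendstoUniformlyOn f g atTop s := by
  rw [Metric.tendstoUniformlyOn_iff]
  intro e he
  have : Tendsto (fun n => C * epsSeq n) atTop (𝓝 0) := by simpa using tendsto_epsSeq.const_mul C
  filter_upwards [this.eventually_lt_const he] with n hn x hx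
  rw [dist_eq_norm, norm_sub_rev]
  exact (h n x hx).trans_lt hn

lemma continuousAt_gaussLimit {p₀ : Plane} (hp : toTorus p₀ ≠ 0) {i j : ℕ} (hij : i + j ≠ 0)
    (hi : i ≤ 2) (hj : j ≤ 2) : ContinuousAt (gaussLimit i j) p₀ := by
  obtain ⟨r, C, hr, hC, h⟩ := exists_gaussLimit_rate hp hij hi hj
  have hunif : TendstoUniformlyOn (fun n p => gaussSum i j (epsSeq n) p) (gaussLimit i j) atTop
      (Metric.ball p₀ r) :=
    tendstoUniformlyOn_of_le_mul_eps fun n p hpr => (h p hpr).2 _ (epsSeq_mem n)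
  refine (hunif.continuousOn (.of_forall fun n => ?_)).continuousAt (Metric.ball_mem_nhds _ hr)
  exact fun p _ => (hasFDerivAt_gaussSum i j (epsSeq_mem n).1 p).continuousAt.continuousWithinAt

lemma gradForm_sub (a b a' b' : ℂ) :
    gradForm a b - gradForm a' b' = gradForm (a - a') (b - b') := by
  simp only [gradForm]; module

lemma norm_gradForm_le (a b : ℂ) :
    ‖gradForm a b‖ ≤ 2 * Real.pi * (‖a‖ * ‖coordForm 0‖ + ‖b‖ * ‖coordForm 1‖) := by
  have hpi : ‖(2 * Real.pi * Complex.I : ℂ)‖ = 2 * Real.pi := by simp [abs_of_pos Real.pi_pos]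
  refine (norm_add_le _ _).trans_eq ?_
  rw [norm_smul, norm_smul, norm_mul _ a, norm_mul _ b, hpi]
  ring

/-- The derivatives converge uniformly near `p₀`, so limit and derivative commute. With `i + j = 1`
the raised exponents stay within the range of the rate estimate. -/
lemma hasFDerivAt_gaussLimit {p₀ : Plane} (hp : toTorus p₀ ≠ 0) {i j : ℕ} (hij : i + j = 1) :
    HasFDerivAt (gaussLimit i j) (gradForm (gaussLimit (i + 1) j p₀) (gaussLimit i (j + 1) p₀))
      p₀ := by
  obtain ⟨r, C, hr, hC, h⟩ := exists_gaussLimit_rate hp (i := i) (j := j)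
    (by omega) (by omega) (by omega)
  obtain ⟨r₁, C₁, hr₁, hC₁, h₁⟩ := exists_gaussLimit_rate hp (i := i + 1) (j := j)
    (by omega) (by omega) (by omega)
  obtain ⟨r₂, C₂, hr₂, hC₂, h₂⟩ := exists_gaussLimit_rate hp (i := i) (j := j + 1)
    (by omega) (by omega) (by omega)
  set ρ := min r (min r₁ r₂)
  have hρ : 0 < ρ := by positivity
  have hsub : Metric.ball p₀ ρ ⊆ Metric.ball p₀ r := Metric.ball_subset_ball (min_le_left _ _)
  have hsub₁ : Metric.ball p₀ ρ ⊆ Metric.ball p₀ r₁ :=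
    Metric.ball_subset_ball ((min_le_right _ _).trans (min_le_left _ _))
  have hsub₂ : Metric.ball p₀ ρ ⊆ Metric.ball p₀ r₂ :=
    Metric.ball_subset_ball ((min_le_right _ _).trans (min_le_right _ _))
  refine hasFDerivAt_of_tendstoUniformlyOn (𝕜 := ℝ) (l := atTop)
    (f := fun n p => gaussSum i j (epsSeq n) p)
    (f' := fun n p => gradForm (gaussSum (i + 1) j (epsSeq n) p) (gaussSum i (j + 1) (epsSeq n) p))
    (g' := fun p => gradForm (gaussLimit (i + 1) j p) (gaussLimit i (j + 1) p))
    Metric.isOpen_ball ?_ (fun n p _ => hasFDerivAt_gaussSum i j (epsSeq_mem n).1 p)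
    (fun p hpr => (h p (hsub hpr)).1.comp tendsto_epsSeq_nhdsGT) (Metric.mem_ball_self hρ)
  refine tendstoUniformlyOn_of_le_mul_eps
    (C := 2 * Real.pi * (C₁ * ‖coordForm 0‖ + C₂ * ‖coordForm 1‖)) fun n p hpr => ?_
  rw [gradForm_sub]
  refine (norm_gradForm_le _ _).trans ?_
  have e₁ := (h₁ p (hsub₁ hpr)).2 _ (epsSeq_mem n)
  have e₂ := (h₂ p (hsub₂ hpr)).2 _ (epsSeq_mem n)
  calc _ ≤ 2 * Real.pi * ((C₁ * epsSeq n) * ‖coordForm 0‖ + (C₂ * epsSeq n) * ‖coordForm 1‖) := by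
        gcongr
    _ = _ := by ring

lemma isOpen_offLattice : IsOpen {p : Plane | toTorus p ≠ 0} :=
  isOpen_ne.preimage continuous_toTorus

lemma contDiffAt_gaussLimit {p₀ : Plane} (hp : toTorus p₀ ≠ 0) {i j : ℕ} (hij : i + j = 1) :
    ContDiffAt ℝ 1 (gaussLimit i j) p₀ := by
  rw [contDiffAt_one_iff]
  refine ⟨fun p => gradForm (gaussLimit (i + 1) j p) (gaussLimit i (j + 1) p), _,
    isOpen_offLattice.mem_nhds hp, fun p hpq => ContinuousAt.continuousWithinAt ?_,
    fun p hpq => hasFDerivAt_gaussLimit hpq hij⟩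
  have h₁ := continuousAt_gaussLimit hpq (i := i + 1) (j := j) (by omega) (by omega) (by omega)
  have h₂ := continuousAt_gaussLimit hpq (i := i) (j := j + 1) (by omega) (by omega) (by omega)
  unfold gradForm
  fun_prop

/-! ### The Biot–Savart kernel off the origin -/

lemma mFourier_toTorus (k : Fin 2 → ℤ) (p : Plane) :
    UnitAddTorus.mFourier k (toTorus p) = planeWave k p := by
  simp only [UnitAddTorus.mFourier, ContinuousMap.coe_mk, Fin.prod_univ_two, toTorus,
    fourier_coe_apply, planeWave]
  rw [← Complex.exp_add]
  congr 1
  push_cast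
  ring

lemma vec_eq (a b : ℝ) :
    (!₂[a, b] : Plane) = a • EuclideanSpace.single 0 1 + b • EuclideanSpace.single 1 1 := by
  ext i
  fin_cases i <;> simp

lemma biotSavartGauss_toTorus {ε : ℝ} (hε : 0 < ε) (p : Plane) :
    biotSavartGauss ε (toTorus p) =
      (1 / (2 * Real.pi)) • !₂[-(gaussSum 0 1 ε p).im, (gaussSum 1 0 ε p).im] := by
  have him : ∀ i j, HasSum (fun k => gaussCoeff i j ε k * (planeWave k p).im)
      (gaussSum i j ε p).im := fun i j => by
    simpa [gaussSum] using Complex.hasSum_im (summable_gaussTerm i j hε p).hasSum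
  have hsum : HasSum (fun k : Fin 2 → ℤ =>
      (Real.exp (-ε * normSq k) * (UnitAddTorus.mFourier k (toTorus p)).im / normSq k) • perp k)
      (!₂[-(gaussSum 0 1 ε p).im, (gaussSum 1 0 ε p).im] : Plane) := by
    rw [vec_eq]
    have hterm : (fun k : Fin 2 → ℤ => (Real.exp (-ε * normSq k) *
        (UnitAddTorus.mFourier k (toTorus p)).im / normSq k) • perp k) = fun k =>
        (-(gaussCoeff 0 1 ε k * (planeWave k p).im)) • EuclideanSpace.single 0 1 +
        (gaussCoeff 1 0 ε k * (planeWave k p).im) • EuclideanSpace.single 1 1 := by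
      funext k
      rw [perp, vec_eq, smul_add, smul_smul, smul_smul, mFourier_toTorus]
      congr 2
      · simp only [gaussCoeff]; ring
      · simp only [gaussCoeff]; ring
    rw [hterm]
    exact ((him 0 1).neg.smul_const _).add ((him 1 0).smul_const _)
  rw [biotSavartGauss, hsum.tsum_eq]

lemma biotSavart_toTorus {p : Plane} (hp : toTorus p ≠ 0) :
    biotSavart (toTorus p) =
      (1 / (2 * Real.pi)) • !₂[-(gaussLimit 0 1 p).im, (gaussLimit 1 0 p).im] := by
  obtain ⟨r, C, hr, -, h⟩ := exists_gaussLimit_rate hp (i := 0) (j := 1)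
    (by omega) (by omega) (by omega)
  obtain ⟨r', C', hr', -, h'⟩ := exists_gaussLimit_rate hp (i := 1) (j := 0)
    (by omega) (by omega) (by omega)
  have h1 := Complex.continuous_im.continuousAt.tendsto.comp (h p (Metric.mem_ball_self hr)).1
  have h2 := Complex.continuous_im.continuousAt.tendsto.comp (h' p (Metric.mem_ball_self hr')).1
  have h3 : Tendsto (fun ε => biotSavartGauss ε (toTorus p)) (𝓝[>] 0)
      (𝓝 ((1 / (2 * Real.pi)) • !₂[-(gaussLimit 0 1 p).im, (gaussLimit 1 0 p).im])) := by
    rw [vec_eq]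
    refine (((h1.neg.smul_const _).add (h2.smul_const _)).const_smul _).congr' ?_
    filter_upwards [self_mem_nhdsWithin] with ε hε
    rw [biotSavartGauss_toTorus hε, vec_eq]
    rfl
  exact h3.limUnder_eq

lemma contDiffAt_biotSavart {p₀ : Plane} (hp : toTorus p₀ ≠ 0) :
    ContDiffAt ℝ 1 (fun p => biotSavart (toTorus p)) p₀ := by
  have h : (fun p : Plane => (1 / (2 * Real.pi)) •
      (!₂[-(gaussLimit 0 1 p).im, (gaussLimit 1 0 p).im] : Plane)) =ᶠ[𝓝 p₀]
      (fun p => biotSavart (toTorus p)) := by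
    filter_upwards [isOpen_offLattice.mem_nhds hp] with p hpq
    rw [biotSavart_toTorus hpq]
  refine ContDiffAt.congr_of_eventuallyEq ?_ h.symm
  refine ContDiffAt.const_smul _ ?_
  rw [contDiffAt_euclidean]
  have h1 := Complex.imCLM.contDiff.contDiffAt.comp p₀ (contDiffAt_gaussLimit hp (i := 0) (j := 1) rfl)
  have h2 := Complex.imCLM.contDiff.contDiffAt.comp p₀ (contDiffAt_gaussLimit hp (i := 1) (j := 0) rfl)
  intro a
  fin_cases a
  · exact h1.neg
  · exact h2

/-! ### Periodic functions on the plane and the cut-off kernel -/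

lemma toTorus_add (p q : Plane) : toTorus (p + q) = toTorus p + toTorus q := by
  ext a; simp [toTorus]

lemma toTorus_sub (p q : Plane) : toTorus (p - q) = toTorus p - toTorus q := by
  ext a; simp [toTorus]

lemma toTorus_surjective : Function.Surjective toTorus := by
  intro y
  choose f hf using fun a => QuotientAddGroup.mk_surjective (y a)
  exact ⟨WithLp.toLp 2 f, funext hf⟩

lemma exists_norm_le_toTorus_eq (p : Plane) : ∃ q : Plane, ‖q‖ ≤ 2 ∧ toTorus q = toTorus p := by
  refine ⟨!₂[Int.fract (p 0), Int.fract (p 1)], ?_, ?_⟩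
  · rw [EuclideanSpace.norm_eq, Real.sqrt_le_left (by norm_num)]
    simp only [Fin.sum_univ_two, Real.norm_eq_abs, sq_abs]
    have h0 := Int.fract_nonneg (p 0)
    have h1 := Int.fract_nonneg (p 1)
    have h2 := (Int.fract_lt_one (p 0)).le
    have h3 := (Int.fract_lt_one (p 1)).le
    simp
    nlinarith
  · have key : ∀ x : ℝ, ((Int.fract x : ℝ) : UnitAddCircle) = (x : UnitAddCircle) := by
      intro x
      have : Int.fract x = x - ⌊x⌋ := rfl
      rw [this, AddCircle.coe_sub, sub_eq_self, AddCircle.coe_eq_zero_iff]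
      exact ⟨⌊x⌋, by simp⟩
    ext a
    fin_cases a
    · exact key _
    · exact key _

/-- A continuous function on the plane that factors through the torus is bounded. -/
lemma exists_norm_le_of_periodic {E : Type*} [NormedAddCommGroup E] {g : Plane → E}
    (hg : Continuous g) (hper : ∀ p q, toTorus p = toTorus q → g p = g q) :
    ∃ M : ℝ≥0, ∀ p, ‖g p‖ ≤ M := by
  obtain ⟨M, hM⟩ := (isCompact_closedBall (0 : Plane) 2).exists_bound_of_continuousOn hg.continuousOn
  refine ⟨M.toNNReal, fun p => ?_⟩
  obtain ⟨q, hq, hqp⟩ := exists_norm_le_toTorus_eq p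
  rw [← hper q p hqp]
  exact (hM q (by simpa using hq)).trans (Real.le_coe_toNNReal M)

lemma exists_bound_and_lipschitz {κ : Torus → Plane}
    (hκ : ContDiff ℝ 1 fun p => κ (toTorus p)) :
    ∃ M L : ℝ≥0, (∀ y, ‖κ y‖ ≤ M) ∧ LipschitzWith L fun p => κ (toTorus p) := by
  obtain ⟨M, hM⟩ := exists_norm_le_of_periodic hκ.continuous fun p q h => by simp only [h]
  -- The derivative inherits the periods: translation by `q - p` leaves the function unchanged.
  obtain ⟨L, hL⟩ := exists_norm_le_of_periodic (hκ.continuous_fderiv one_ne_zero) fun p q h => by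
    have hper : (fun r => κ (toTorus (r + (q - p)))) = fun r => κ (toTorus r) := by
      funext r
      rw [toTorus_add, toTorus_sub, h, sub_self, add_zero]
    have := fderiv_comp_add_right (𝕜 := ℝ) (f := fun r => κ (toTorus r)) (x := p) (q - p)
    rw [hper, add_sub_cancel] at this
    exact this
  refine ⟨M, L, fun y => ?_, lipschitzWith_of_nnnorm_fderiv_le
    (hκ.differentiable one_ne_zero) hL⟩
  obtain ⟨p, rfl⟩ := toTorus_surjective y
  exact hM p

/-- A cut-off kernel that is smooth at the origin is smooth everywhere. -/
lemma contDiff_cutoffKernel {χ : Torus → ℝ}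
    (hχ : ContDiff ℝ 1 fun p : Plane => χ (toTorus p))
    (hK : ContDiffAt ℝ 1 (fun p : Plane => cutoffKernel χ (toTorus p)) 0) :
    ContDiff ℝ 1 fun p : Plane => cutoffKernel χ (toTorus p) := by
  rw [contDiff_iff_contDiffAt]
  intro p
  by_cases hp : toTorus p = 0
  · have h1 : (fun q : Plane => cutoffKernel χ (toTorus q)) =
        (fun q : Plane => cutoffKernel χ (toTorus q)) ∘ fun q => q - p := by
      funext q
      simp [toTorus_sub, hp]
    rw [h1]
    refine ContDiffAt.comp p ?_ (by fun_prop)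
    rwa [sub_self]
  · exact (contDiffAt_const.sub hχ.contDiffAt).smul (contDiffAt_biotSavart hp)

/-! ### The split vector fields on the universal cover -/

/-- The velocity of the `i`-th vortex as a function on the universal cover. -/
def liftVelocity {N : ℕ} (κ : Torus → Plane) (ξ : Fin N → ℝ) (i : Fin N) (X : Fin N → Plane) :
    Plane := velocity κ ξ i fun j => toTorus (X j)

/-- The vector field that moves only the `i`-th vortex. -/
def splitField {N : ℕ} (κ : Torus → Plane) (ξ : Fin N → ℝ) (i : Fin N) (X : Fin N → Plane) :
    Fin N → Plane := Pi.single i (liftVelocity κ ξ i X)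

lemma sum_splitField {N : ℕ} (κ : Torus → Plane) (ξ : Fin N → ℝ) (X : Fin N → Plane) :
    ∑ i, splitField κ ξ i X = fun i => velocity κ ξ i fun j => toTorus (X j) :=
  Finset.univ_sum_single _

lemma liftVelocity_eq {N : ℕ} (κ : Torus → Plane) (ξ : Fin N → ℝ) (i : Fin N) :
    liftVelocity κ ξ i = fun X =>
      ∑ j ∈ Finset.univ.erase i, ξ j • (fun p => κ (toTorus p)) (X i - X j) := by
  funext X
  simp only [liftVelocity, velocity, toTorus_sub]

lemma differentiable_splitField {N : ℕ} {κ : Torus → Plane} (ξ : Fin N → ℝ)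
    (hκ : ContDiff ℝ 1 fun p => κ (toTorus p)) (i : Fin N) :
    Differentiable ℝ (splitField κ ξ i) := by
  have h : Differentiable ℝ (liftVelocity κ ξ i) := by
    rw [liftVelocity_eq]
    refine Differentiable.fun_sum fun j _ => Differentiable.fun_const_smul ?_ _
    exact (hκ.differentiable one_ne_zero).comp (g := fun p => κ (toTorus p))
      (f := fun X : Fin N → Plane => X i - X j) (by fun_prop)
  exact (ContinuousLinearMap.single ℝ (fun _ : Fin N => Plane) i).differentiable.comp h

lemma exists_bound_and_lipschitz_splitField {N : ℕ} {κ : Torus → Plane} (ξ : Fin N → ℝ)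
    (hκ : ContDiff ℝ 1 fun p => κ (toTorus p)) :
    ∃ M L : ℝ≥0, ∀ i, (∀ X, ‖splitField κ ξ i X‖ ≤ M) ∧ LipschitzWith L (splitField κ ξ i) := by
  obtain ⟨M, L, hM, hL⟩ := exists_bound_and_lipschitz hκ
  have hnorm : ∀ (i : Fin N) (v : Plane), ‖(Pi.single i v : Fin N → Plane)‖ = ‖v‖ :=
    fun i v => Pi.norm_single (G := fun _ : Fin N => Plane) v
  refine ⟨∑ j, ‖ξ j‖₊ * M, ∑ j, ‖ξ j‖₊ * (L * 2), fun i => ⟨fun X => ?_, ?_⟩⟩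
  · rw [splitField, hnorm, liftVelocity, velocity]
    push_cast
    calc _ ≤ ∑ j ∈ Finset.univ.erase i, ‖ξ j‖ * (M : ℝ) := by
          refine norm_sum_le_of_le _ fun j _ => ?_
          rw [norm_smul]; gcongr; exact hM _
      _ ≤ _ := Finset.sum_le_univ_sum_of_nonneg fun j => by positivity
  · refine LipschitzWith.of_dist_le_mul fun X Y => ?_
    rw [dist_eq_norm, splitField, splitField, ← Pi.single_sub, hnorm, liftVelocity_eq]
    simp only [← Finset.sum_sub_distrib, ← smul_sub]
    push_cast
    rw [Finset.sum_mul]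
    calc _ ≤ ∑ j ∈ Finset.univ.erase i, ‖ξ j‖ * (L * 2) * dist X Y := by
          refine norm_sum_le_of_le _ fun j _ => ?_
          rw [norm_smul, mul_assoc, mul_assoc]
          gcongr
          rw [← dist_eq_norm]
          refine (hL.dist_le_mul _ _).trans ?_
          gcongr
          calc dist (X i - X j) (Y i - Y j) ≤ dist (X i) (Y i) + dist (X j) (Y j) :=
                dist_sub_sub_le _ _ _ _
            _ ≤ dist X Y + dist X Y := add_le_add (dist_le_pi_dist _ _ _) (dist_le_pi_dist _ _ _)
            _ = 2 * dist X Y := by ring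
      _ ≤ _ := Finset.sum_le_univ_sum_of_nonneg fun j => by positivity

/-! ### Global solutions and switched vector fields -/

/-- A bounded Lipschitz vector field has global solutions. -/
lemma exists_global_solution {E : Type*} [NormedAddCommGroup E] [NormedSpace ℝ E] [CompleteSpace E]
    {F : E → E} {M L : ℝ≥0} (hM : ∀ x, ‖F x‖ ≤ M) (hL : LipschitzWith L F) (x : E) :
    ∃ φ : ℝ → E, φ 0 = x ∧ ∀ t, HasDerivAt φ (F (φ t)) t := by
  have hlocal : ∀ n : ℕ, ∃ α : ℝ → E, α 0 = x ∧
      ∀ t ∈ Ioo (-(n + 1 : ℝ)) (n + 1), HasDerivAt α (F (α t)) t := by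
    intro n
    have h0 : (0 : ℝ) ∈ Icc (-(n + 1 : ℝ)) (n + 1) := ⟨by linarith [n.cast_nonneg (α := ℝ)],
      by positivity⟩
    -- At speed at most `M`, a solution cannot leave the ball of radius `M (n + 1)` within time `n +
    -- 1`.
    have hpl : IsPicardLindelof (fun _ => F) (tmin := -(n + 1 : ℝ)) (tmax := n + 1) ⟨0, h0⟩ x
        (M * (n + 1)) 0 M L :=
      { lipschitzOnWith := fun _ _ => hL.lipschitzOnWith
        continuousOn := fun _ _ => continuousOn_const
        norm_le := fun _ _ y _ => hM y
        mul_max_le := by simp }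
    obtain ⟨α, hα0, hα⟩ := hpl.exists_eq_forall_mem_Icc_hasDerivWithinAt₀
    exact ⟨α, hα0, fun t ht => (hα t (Ioo_subset_Icc_self ht)).hasDerivAt (Icc_mem_nhds ht.1 ht.2)⟩
  choose α hα0 hα using hlocal
  have hagree : ∀ m n : ℕ, m ≤ n → EqOn (α m) (α n) (Ioo (-(m + 1 : ℝ)) (m + 1)) := by
    intro m n hmn
    have hmn' : (m : ℝ) ≤ n := by exact_mod_cast hmn
    have h0 : (0 : ℝ) ∈ Ioo (-(m + 1 : ℝ)) (m + 1) :=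
      ⟨by linarith [m.cast_nonneg (α := ℝ)], by positivity⟩
    refine ODE_solution_unique_of_mem_Ioo (v := fun _ => F) (s := fun _ => univ) (K := L)
      (fun _ _ => hL.lipschitzOnWith) h0 (fun t ht => ⟨hα m t ht, trivial⟩)
      (fun t ht => ⟨hα n t ⟨by linarith [ht.1], by linarith [ht.2]⟩, trivial⟩) ?_
    rw [hα0, hα0]
  have hmem : ∀ t : ℝ, t ∈ Ioo (-(⌈|t|⌉₊ + 1 : ℝ)) (⌈|t|⌉₊ + 1) := fun t => by
    rw [mem_Ioo, ← abs_lt]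
    exact (Nat.le_ceil _).trans_lt (lt_add_one _)
  refine ⟨fun t => α ⌈|t|⌉₊ t, hα0 _, fun t => ?_⟩
  refine (hα _ t (hmem t)).congr_of_eventuallyEq ?_
  filter_upwards [isOpen_Ioo.mem_nhds (hmem t)] with s hs
  rcases le_total ⌈|s|⌉₊ ⌈|t|⌉₊ with h | h
  · exact hagree _ _ h (hmem s)
  · exact (hagree _ _ h hs).symm

/-- Curves `c n` on `[0, 1]`, each ending where the next one starts, glued together and run at
speed `h`. -/
def glue {E : Type*} (c : ℕ → ℝ → E) (h t : ℝ) : E := c ⌊h * t⌋₊ (h * t - ⌊h * t⌋₊)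

lemma glue_zero {E : Type*} (c : ℕ → ℝ → E) (h : ℝ) : glue c h 0 = c 0 0 := by simp [glue]

section Glue

variable {E : Type*} [NormedAddCommGroup E] [NormedSpace ℝ E] {c c' : ℕ → ℝ → E} {h : ℝ}

lemma hasDerivAt_rescale (hc : ∀ n s, HasDerivAt (c n) (c' n s) s) (n : ℕ) (t : ℝ) :
    HasDerivAt (fun t => c n (h * t - n)) (h • c' n (h * t - n)) t := by
  have h1 : HasDerivAt (fun t : ℝ => h * t - n) h t := by
    simpa using ((hasDerivAt_id t).const_mul h).sub_const (n : ℝ)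
  exact (hc n (h * t - n)).scomp t h1

lemma hasDerivWithinAt_glue (hc : ∀ n s, HasDerivAt (c n) (c' n s) s) (hh : 0 < h) {t : ℝ}
    (ht : 0 ≤ t) :
    HasDerivWithinAt (glue c h) (h • c' ⌊h * t⌋₊ (h * t - ⌊h * t⌋₊)) (Ici t) t := by
  refine (hasDerivAt_rescale hc ⌊h * t⌋₊ t).hasDerivWithinAt.congr_of_eventuallyEq ?_ rfl
  have hlt : t < (⌊h * t⌋₊ + 1) / h := by
    rw [lt_div_iff₀ hh, mul_comm]; exact Nat.lt_floor_add_one _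
  filter_upwards [Ico_mem_nhdsGE hlt] with r hr
  have : ⌊h * r⌋₊ = ⌊h * t⌋₊ := by
    rw [Nat.floor_eq_iff (mul_nonneg hh.le (ht.trans hr.1))]
    constructor
    · exact (Nat.floor_le (mul_nonneg hh.le ht)).trans (by gcongr; exact hr.1)
    · rw [mul_comm, ← lt_div_iff₀ hh]; exact hr.2
  simp only [glue, this]

lemma continuousOn_glue (hc : ∀ n s, HasDerivAt (c n) (c' n s) s)
    (hglue : ∀ n, c n 1 = c (n + 1) 0) (hh : 0 < h) : ContinuousOn (glue c h) (Ici 0) := by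
  intro t ht
  rw [mem_Ici] at ht
  have hright := (hasDerivWithinAt_glue hc hh ht).continuousWithinAt
  rcases ht.eq_or_lt with rfl | ht0
  · exact hright
  refine ContinuousAt.continuousWithinAt (continuousAt_iff_continuous_left_right.2 ⟨?_, hright⟩)
  -- The piece in force just before `t` has index `⌈h t⌉ - 1`. At a switching time this differs from
  -- `⌊h t⌋`, and `hglue` joins the two.
  obtain ⟨n, hn⟩ : ∃ n : ℕ, ⌈h * t⌉₊ = n + 1 :=
    Nat.exists_eq_succ_of_ne_zero (Nat.ceil_pos.2 (mul_pos hh ht0)).ne'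
  rw [Nat.ceil_eq_iff (by omega)] at hn
  obtain ⟨hn1, hn2⟩ := hn
  simp only [Nat.add_sub_cancel, Nat.cast_add, Nat.cast_one] at hn1 hn2
  have key : ∀ r, (n : ℝ) / h < r → r ≤ t → glue c h r = c n (h * r - n) := by
    intro r hr1 hr2
    rw [div_lt_iff₀' hh] at hr1
    have hr3 : h * r ≤ n + 1 := (by gcongr : h * r ≤ h * t).trans hn2
    rcases hr3.eq_or_lt with hr | hr
    · have hfl : ⌊h * r⌋₊ = n + 1 := by
        rw [hr]; exact_mod_cast Nat.floor_natCast (n + 1)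
      rw [glue, hfl, hr]
      push_cast
      rw [sub_self, ← hglue, add_sub_cancel_left]
    · have hfl : ⌊h * r⌋₊ = n := by
        rw [Nat.floor_eq_iff (n.cast_nonneg.trans hr1.le)]; exact ⟨hr1.le, hr⟩
      rw [glue, hfl]
  have hnt : (n : ℝ) / h < t := by rwa [div_lt_iff₀' hh]
  refine (hasDerivAt_rescale (h := h) hc n t).continuousAt.continuousWithinAt.congr_of_eventuallyEq
    ?_ (key t hnt le_rfl)
  filter_upwards [Ioc_mem_nhdsLE hnt] with r hr
  exact key r hr.1 hr.2

/-- Existence of solutions when the vector field is switched at the multiples of `1 / h`. -/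
lemma exists_switched_solution [CompleteSpace E] {F : ℕ → E → E} {M L : ℕ → ℝ≥0}
    (hM : ∀ n x, ‖F n x‖ ≤ M n) (hL : ∀ n, LipschitzWith (L n) (F n)) (hh : 0 < h) (x : E) :
    ∃ X : ℝ → E, X 0 = x ∧ ContinuousOn X (Ici 0) ∧
      ∀ t, 0 ≤ t → HasDerivWithinAt X (h • F ⌊h * t⌋₊ (X t)) (Ici t) t := by
  choose φ hφ0 hφ using fun n x => exists_global_solution (hM n) (hL n) x
  -- The positions at the switching times.
  let y : ℕ → E := fun n => Nat.rec x (fun n z => φ n z 1) n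
  have hc : ∀ n s, HasDerivAt (φ n (y n)) (F n (φ n (y n) s)) s := fun n s => hφ n (y n) s
  exact ⟨glue (fun n => φ n (y n)) h, (glue_zero _ _).trans (hφ0 _ _),
    continuousOn_glue hc (fun n => by rw [hφ0]) hh,
    fun t ht => hasDerivWithinAt_glue hc hh ht⟩

end Glue

/-! ### The averaging estimate -/

/-- Averaging: if at each time only one of the fields `F j` acts, with intensity `a`, and the
accumulated intensities of all fields stay `η`-close to the elapsed time, then the trajectory is
`O(η)`-close to that of `∑ j, F j`. The discrepancies are `D j`. -/
lemma norm_sub_le_of_intensities {E : Type*} [NormedAddCommGroup E] [NormedSpace ℝ E] {N : ℕ}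
    {F : Fin N → E → E} {M L : ℝ≥0} (hFM : ∀ i x, ‖F i x‖ ≤ M)
    (hFL : ∀ i, LipschitzWith L (F i)) (hFd : ∀ i, Differentiable ℝ (F i))
    {X Y : ℝ → E} {a : ℝ → ℝ} {σ : ℝ → Fin N} {D : Fin N → ℝ → ℝ} {η : ℝ} (hη : 0 < η)
    (h0 : X 0 = Y 0) (ha : ∀ t, 0 ≤ a t)
    (hXc : ContinuousOn X (Icc 0 1)) (hYc : ContinuousOn Y (Icc 0 1))
    (hX : ∀ t ∈ Ico (0 : ℝ) 1, HasDerivWithinAt X (a t • F (σ t) (X t)) (Ici t) t)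
    (hY : ∀ t ∈ Ico (0 : ℝ) 1, HasDerivWithinAt Y (∑ j, F j (Y t)) (Ici t) t)
    (hD0 : ∀ j, D j 0 = 0) (hDc : ∀ j, ContinuousOn (D j) (Icc 0 1))
    (hD : ∀ j, ∀ t ∈ Ico (0 : ℝ) 1,
      HasDerivWithinAt (D j) ((if σ t = j then a t else 0) - 1) (Ici t) t)
    (hDη : ∀ j, ∀ t ∈ Icc (0 : ℝ) 1, |D j t| ≤ η) {t : ℝ} (ht : t ∈ Icc (0 : ℝ) 1) :
    ‖X t - Y t‖ ≤ N * M * η +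
      (N * M + N * L * (N * M) + 1) * η * Real.exp (2 * L * (N + 2 * N * η) + 1) := by
  -- `K η` dominates both error terms; the `+ 1` makes the second domination strict, as the fencing
  -- argument requires.
  set K : ℝ := N * M + N * L * (N * M) + 1 with hK
  -- The corrector integrates the oscillating forcing by parts: it has size `O(η)`, and its
  -- derivative removes `a F_σ(Y) - ∑ F_j(Y)`.
  set Z : ℝ → E := fun t => X t - Y t - ∑ j, D j t • F j (Y t) with hZ
  -- The sum in the exponent has derivative `a`, the shift by `η` keeps it nonnegative, and the
  -- final `+ t` yields an extra `B` that pays for the corrector's error.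
  set B : ℝ → ℝ := fun t => K * η * Real.exp (2 * L * (∑ j, (D j t + t + η)) + t) with hB
  have hcorr : ∀ t ∈ Icc (0 : ℝ) 1, ‖X t - Y t‖ ≤ ‖Z t‖ + N * M * η := by
    intro t ht
    have h1 : X t - Y t = Z t + ∑ j, D j t • F j (Y t) := by simp [hZ]
    rw [h1]
    refine (norm_add_le _ _).trans (by
      gcongr
      calc ‖∑ j, D j t • F j (Y t)‖ ≤ ∑ _j : Fin N, η * M := by
            refine norm_sum_le_of_le _ fun j _ => ?_
            rw [norm_smul, Real.norm_eq_abs]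
            gcongr
            · exact hDη j t ht
            · exact hFM _ _
        _ = N * M * η := by simp; ring)
  have hZc : ContinuousOn Z (Icc 0 1) :=
    (hXc.sub hYc).sub (continuousOn_finsetSum _ fun j _ =>
      (hDc j).smul ((hFd j).continuous.comp_continuousOn hYc))
  have hZ' : ∀ t ∈ Ico (0 : ℝ) 1, HasDerivWithinAt Z
      (a t • (F (σ t) (X t) - F (σ t) (Y t)) -
        ∑ j, D j t • fderiv ℝ (F j) (Y t) (∑ i, F i (Y t))) (Ici t) t := by
    intro t ht
    have h1 : HasDerivWithinAt (fun t => ∑ j, D j t • F j (Y t))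
        (∑ j, (D j t • fderiv ℝ (F j) (Y t) (∑ i, F i (Y t)) +
          ((if σ t = j then a t else 0) - 1) • F j (Y t))) (Ici t) t :=
      HasDerivWithinAt.fun_sum fun j _ => (hD j t ht).smul
        ((hFd j (Y t)).hasFDerivAt.comp_hasDerivWithinAt t (hY t ht))
    refine (((hX t ht).sub (hY t ht)).sub h1).congr_deriv ?_
    simp only [Finset.sum_add_distrib, sub_smul, ite_smul, zero_smul, one_smul,
      Finset.sum_sub_distrib, Finset.sum_ite_eq, Finset.mem_univ, if_true, smul_sub]
    abel
  have hBc : ContinuousOn B (Icc 0 1) := by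
    have : ContinuousOn (fun t => ∑ j, (D j t + t + η)) (Icc 0 1) :=
      continuousOn_finsetSum _ fun j _ => ((hDc j).add continuousOn_id).add continuousOn_const
    exact continuousOn_const.mul
      (Real.continuous_exp.comp_continuousOn ((continuousOn_const.mul this).add continuousOn_id))
  have hB' : ∀ t ∈ Ico (0 : ℝ) 1, HasDerivWithinAt B ((2 * L * a t + 1) * B t) (Ici t) t := by
    intro t ht
    have h1 : HasDerivWithinAt (fun t => ∑ j, (D j t + t + η))
        (∑ j, ((if σ t = j then a t else 0) - 1 + 1)) (Ici t) t :=
      HasDerivWithinAt.fun_sum fun j _ => ((hD j t ht).add (hasDerivWithinAt_id _ _)).add_const _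
    have h2 : ∑ j, ((if σ t = j then a t else 0) - 1 + 1) = a t := by simp
    rw [h2] at h1
    refine ((((h1.const_mul (2 * (L : ℝ))).add (hasDerivWithinAt_id _ _)).exp).const_mul
      (K * η)).congr_deriv ?_
    simp only [hB, Pi.add_apply, id]
    ring
  have hsum_le : ∀ t ∈ Icc (0 : ℝ) 1, 0 ≤ ∑ j, (D j t + t + η) ∧
      ∑ j, (D j t + t + η) ≤ N + 2 * N * η := by
    intro t ht
    refine ⟨Finset.sum_nonneg fun j _ => ?_, ?_⟩
    · linarith [(abs_le.1 (hDη j t ht)).1, ht.1]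
    · calc ∑ j, (D j t + t + η) ≤ ∑ _j : Fin N, (1 + 2 * η) :=
            Finset.sum_le_sum fun j _ => by linarith [(abs_le.1 (hDη j t ht)).2, ht.2]
        _ = N + 2 * N * η := by simp; ring
  have hK0 : 0 < K := by positivity
  have hBK : ∀ t ∈ Icc (0 : ℝ) 1, K * η ≤ B t := by
    intro t ht
    refine le_mul_of_one_le_right (by positivity) (Real.one_le_exp ?_)
    have := (hsum_le t ht).1
    have := ht.1
    positivity
  have hfence := image_norm_le_of_norm_deriv_right_lt_deriv_boundary' (f := Z) (B := B)
    (B' := fun t => (2 * L * a t + 1) * B t) hZc hZ' (by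
      have hZ0 : Z 0 = 0 := by simp [hZ, h0, hD0]
      rw [hZ0, norm_zero]
      exact (by positivity : 0 ≤ K * η).trans (hBK 0 ⟨le_rfl, zero_le_one⟩)) hBc hB' (by
      intro t ht hZB
      have ht' := Ico_subset_Icc_self ht
      have hd : ‖∑ j, D j t • fderiv ℝ (F j) (Y t) (∑ i, F i (Y t))‖ ≤ N * L * (N * M) * η := by
        have hs : ‖∑ i, F i (Y t)‖ ≤ N * M := by
          calc _ ≤ ∑ _i : Fin N, (M : ℝ) := norm_sum_le_of_le _ fun i _ => hFM _ _
            _ = N * M := by simp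
        calc _ ≤ ∑ _j : Fin N, η * (L * (N * M)) := by
              refine norm_sum_le_of_le _ fun j _ => ?_
              rw [norm_smul, Real.norm_eq_abs]
              gcongr
              · exact hDη j t ht'
              · refine (ContinuousLinearMap.le_opNorm _ _).trans ?_
                gcongr
                exact norm_fderiv_le_of_lipschitz ℝ (hFL j)
          _ = _ := by simp; ring
      have hm : ‖a t • (F (σ t) (X t) - F (σ t) (Y t))‖ ≤ a t * (L * (B t + N * M * η)) := by
        rw [norm_smul, Real.norm_of_nonneg (ha t)]
        have := ha t
        gcongr
        refine ((hFL _).norm_sub_le _ _).trans ?_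
        gcongr
        rw [← hZB]
        exact hcorr t ht'
      have h1 := hBK t ht'
      have h2 : N * M * η ≤ B t := by
        have : N * M * η ≤ K * η := by
          gcongr
          have : (0 : ℝ) ≤ N * L * (N * M) := by positivity
          linarith
        linarith
      have h3 : N * L * (N * M) * η < B t := by
        have : N * L * (N * M) * η < K * η := by
          gcongr
          have : (0 : ℝ) ≤ N * M := by positivity
          linarith
        linarith
      have h4 : a t * (L * (B t + N * M * η)) ≤ a t * (L * (B t + B t)) := by
        have := ha t
        gcongr
      calc _ ≤ a t * (L * (B t + N * M * η)) + N * L * (N * M) * η :=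
            (norm_sub_le _ _).trans (add_le_add hm hd)
        _ < a t * (L * (B t + B t)) + B t := by linarith
        _ = _ := by ring)
  have hBt : B t ≤ K * η * Real.exp (2 * L * (N + 2 * N * η) + 1) := by
    have := (hsum_le t ht).2
    have := ht.2
    simp only [hB]
    gcongr
  linarith [hcorr t ht, hfence ht]

/-! ### Discrepancies between granted and elapsed time -/

/-- The total time granted to the `j`-th vortex in the first `n` steps. -/
def grantedTime {N : ℕ} [NeZero N] (τ : ℕ → ℝ) (j : Fin N) (n : ℕ) : ℝ :=
  ∑ i ∈ Finset.range n, if Fin.ofNat N i = j then τ i else 0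

/-- The difference between the time granted to the `j`-th vortex, interpolated linearly, and the
elapsed time. -/
def discrepancy {N : ℕ} [NeZero N] (τ : ℕ → ℝ) (m : ℕ) (j : Fin N) : ℝ → ℝ :=
  glue (fun n s => (grantedTime τ j n - n / N +
    s * ((if Fin.ofNat N n = j then τ n else 0) - 1 / N)) / m) (N * m)

section Discrepancy

variable {N : ℕ} [NeZero N] (τ : ℕ → ℝ) {m : ℕ} (j : Fin N)

lemma hasDerivAt_discrepancy_piece (m n : ℕ) (s : ℝ) :
    HasDerivAt (fun s : ℝ => (grantedTime τ j n - n / N +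
      s * ((if Fin.ofNat N n = j then τ n else 0) - 1 / N)) / m)
      (((if Fin.ofNat N n = j then τ n else 0) - 1 / N) / m) s := by
  simpa using ((((hasDerivAt_id s).mul_const
    ((if Fin.ofNat N n = j then τ n else 0) - 1 / (N : ℝ))).const_add
    (grantedTime τ j n - n / N)).div_const (m : ℝ))

lemma discrepancy_zero (m : ℕ) : discrepancy τ m j 0 = 0 := by
  simp [discrepancy, glue_zero, grantedTime]

lemma speed_pos (N : ℕ) [NeZero N] (hm : 1 ≤ m) : (0 : ℝ) < N * m := by
  have := NeZero.pos N
  positivity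

lemma continuousOn_discrepancy (hm : 1 ≤ m) : ContinuousOn (discrepancy τ m j) (Ici 0) := by
  refine continuousOn_glue (fun n s => hasDerivAt_discrepancy_piece τ j m n s) (fun n => ?_)
    (speed_pos N hm)
  simp only [grantedTime, Finset.sum_range_succ]
  push_cast
  ring

lemma hasDerivWithinAt_discrepancy (hm : 1 ≤ m) {t : ℝ} (ht : 0 ≤ t) :
    HasDerivWithinAt (discrepancy τ m j)
      ((if Fin.ofNat N ⌊(N : ℝ) * m * t⌋₊ = j then N * τ ⌊(N : ℝ) * m * t⌋₊ else 0) - 1)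
      (Ici t) t := by
  refine (hasDerivWithinAt_glue (fun n s => hasDerivAt_discrepancy_piece τ j m n s)
    (speed_pos N hm) ht).congr_deriv ?_
  have hN : (N : ℝ) ≠ 0 := NeZero.ne _
  have hm' : (m : ℝ) ≠ 0 := by positivity
  rw [smul_eq_mul]
  split_ifs
  · field_simp
  · field_simp
    ring

lemma abs_discrepancy_le {e C : ℝ} (he : 0 ≤ e) (hm : 1 ≤ m)
    (h : ∀ n : ℕ, |grantedTime τ j n - n / N| ≤ e * n + C) {t : ℝ} (ht : t ∈ Icc (0 : ℝ) 1) :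
    |discrepancy τ m j t| ≤ e * N + (e + C) / m := by
  have hm0 : (0 : ℝ) < m := by positivity
  have hpos := speed_pos (m := m) N hm
  have hnn : 0 ≤ (N : ℝ) * m * t := mul_nonneg hpos.le ht.1
  set n := ⌊(N : ℝ) * m * t⌋₊ with hn
  set s := (N : ℝ) * m * t - n with hs
  have hs0 : 0 ≤ s := sub_nonneg.2 (Nat.floor_le hnn)
  have hs1 : 0 ≤ 1 - s := by linarith [Nat.lt_floor_add_one ((N : ℝ) * m * t)]
  have hnle : (n : ℝ) ≤ N * m := (Nat.floor_le hnn).trans (mul_le_of_le_one_right hpos.le ht.2)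
  -- Linear interpolation is a convex combination of the values at steps `n` and `n + 1`, so the
  -- bound at the integers carries over.
  have heq : discrepancy τ m j t = ((1 - s) * (grantedTime τ j n - n / N) +
      s * (grantedTime τ j (n + 1) - (n + 1 : ℕ) / N)) / m := by
    simp only [discrepancy, glue, ← hn, ← hs]
    simp only [grantedTime, Finset.sum_range_succ]
    push_cast
    ring
  have h2 := h (n + 1)
  have h1 : |grantedTime τ j n - n / N| ≤ e * (n + 1 : ℕ) + C := (h n).trans (by
    push_cast; nlinarith)
  rw [heq, abs_div, abs_of_pos hm0]
  calc _ ≤ ((1 - s) * (e * (n + 1 : ℕ) + C) + s * (e * (n + 1 : ℕ) + C)) / m := by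
        gcongr
        refine (abs_add_le _ _).trans ?_
        rw [abs_mul, abs_mul, abs_of_nonneg hs0, abs_of_nonneg hs1]
        gcongr
    _ = (e * (n + 1) + C) / m := by push_cast; ring
    _ ≤ (e * (N * m + 1) + C) / m := by gcongr
    _ = _ := by field_simp; ring

/-- The steps granted to the `j`-th vortex are those with numbers `j, j + N, j + 2 N, …`. -/
lemma grantedTime_eq (n : ℕ) :
    grantedTime τ j n = ∑ k ∈ Finset.range (n.count (· ≡ j [MOD N])), τ (j + N * k) := by
  induction n with
  | zero => simp [grantedTime]
  | succ n ih =>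
    have hiff : Fin.ofNat N n = j ↔ n ≡ j [MOD N] := by
      rw [Fin.ext_iff, Nat.ModEq, Nat.mod_eq_of_lt j.2]; rfl
    rw [grantedTime, Finset.sum_range_succ, ← grantedTime, ih, Nat.count_succ]
    by_cases hn : n ≡ j [MOD N]
    · have hmod : n % N = j := by rw [hn, Nat.mod_eq_of_lt j.2]
      have hcount : n.count (· ≡ j [MOD N]) = n / N := by
        rw [Nat.count_modEq_card _ (NeZero.pos N), Nat.mod_eq_of_lt j.2, hmod]; simp
      have h3 : (j : ℕ) + N * (n / N) = n := by rw [← hmod, Nat.mod_add_div]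
      rw [if_pos (hiff.2 hn), if_pos hn, Finset.sum_range_succ, hcount, h3]
    · rw [if_neg (mt hiff.1 hn), if_neg hn, add_zero, add_zero]

lemma exists_abs_sum_sub_le {u : ℕ → ℝ}
    (h : Tendsto (fun n : ℕ => (∑ i ∈ Finset.range n, u i) / n) atTop (𝓝 1)) {e : ℝ} (he : 0 < e) :
    ∃ C, ∀ n : ℕ, |∑ i ∈ Finset.range n, u i - n| ≤ e * n + C := by
  obtain ⟨n₀, hn₀⟩ := (Metric.tendsto_atTop.1 h) e he
  -- The constant absorbs the finitely many early deviations; including `n₀` itself forces `n > 0`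
  -- in the remaining case.
  refine ⟨∑ n ∈ Finset.range (n₀ + 1), |∑ i ∈ Finset.range n, u i - n|, fun n => ?_⟩
  by_cases hn : n < n₀ + 1
  · have := Finset.single_le_sum (f := fun n : ℕ => |∑ i ∈ Finset.range n, u i - n|)
      (fun _ _ => abs_nonneg _) (Finset.mem_range.2 hn)
    exact this.trans (le_add_of_nonneg_left (by positivity))
  · have hn1 : (0 : ℝ) < n := by
      have : 0 < n := by omega
      exact_mod_cast this
    have h1 := (hn₀ n (by omega)).le
    rw [Real.dist_eq, div_sub_one hn1.ne', abs_div, abs_of_pos hn1, div_le_iff₀ hn1] at h1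
    exact h1.trans (le_add_of_nonneg_right (Finset.sum_nonneg fun _ _ => abs_nonneg _))

/-- Among the first `n` steps the vortex receives `n / N` up to an error of one, which only enlarges
the constant. -/
lemma exists_abs_grantedTime_sub_le
    (h : Tendsto (fun n : ℕ => (∑ k ∈ Finset.range n, τ (j + N * k)) / n) atTop (𝓝 1)) {e : ℝ}
    (he : 0 < e) : ∃ C, ∀ n : ℕ, |grantedTime τ j n - n / N| ≤ e * n + C := by
  obtain ⟨C, hC⟩ := exists_abs_sum_sub_le h he
  refine ⟨C + 1, fun n => ?_⟩
  set q := n.count (· ≡ j [MOD N]) with hq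
  have hqn : (q : ℝ) ≤ n := Nat.cast_le.2 (Nat.count_le _)
  have hqN : |(q : ℝ) - n / N| ≤ 1 := by
    have hN : (0 : ℝ) < N := by exact_mod_cast NeZero.pos N
    have h1 : ((n / N : ℕ) : ℝ) ≤ n / N := Nat.cast_div_le
    have h2 : (n : ℝ) / N < (n / N : ℕ) + 1 := by
      rw [div_lt_iff₀ hN]
      rw [mul_comm]
      exact_mod_cast Nat.lt_mul_div_succ n (NeZero.pos N)
    have h3 : (n / N : ℕ) ≤ q ∧ q ≤ n / N + 1 := by
      rw [hq, Nat.count_modEq_card _ (NeZero.pos N)]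
      split_ifs <;> omega
    have h4 : ((n / N : ℕ) : ℝ) ≤ q := by exact_mod_cast h3.1
    have h5 : (q : ℝ) ≤ (n / N : ℕ) + 1 := by exact_mod_cast h3.2
    rw [abs_le]; constructor <;> linarith
  rw [grantedTime_eq, ← hq]
  calc _ ≤ |∑ k ∈ Finset.range q, τ (j + N * k) - q| + |(q : ℝ) - n / N| := abs_sub_le _ _ _
    _ ≤ (e * q + C) + 1 := add_le_add (hC q) hqN
    _ ≤ (e * n + C) + 1 := by gcongr
    _ = _ := by ring

end Discrepancy

/-- Uniform smallness of the discrepancies, from the law of large numbers along the steps of each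
vortex. -/
lemma eventually_abs_discrepancy_le {N : ℕ} [NeZero N] {τ : ℕ → ℝ}
    (h : ∀ j : Fin N,
      Tendsto (fun n : ℕ => (∑ k ∈ Finset.range n, τ (j + N * k)) / n) atTop (𝓝 1))
    {η : ℝ} (hη : 0 < η) :
    ∀ᶠ m : ℕ in atTop, ∀ j : Fin N, ∀ t ∈ Icc (0 : ℝ) 1, |discrepancy τ m j t| ≤ η := by
  rw [eventually_all]
  intro j
  have hN : (0 : ℝ) < N := by exact_mod_cast NeZero.pos N
  -- The bound from `abs_discrepancy_le` then tends to `e N = η / 2`, strictly below `η`.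
  set e := η / (2 * N) with he
  have he0 : 0 < e := by positivity
  obtain ⟨C, hC⟩ := exists_abs_grantedTime_sub_le τ j (h j) he0
  have hlim : Tendsto (fun m : ℕ => e * N + (e + C) / m) atTop (𝓝 (e * N)) := by
    simpa using (tendsto_const_div_atTop_nhds_zero_nat (e + C)).const_add (e * N)
  have hlt : e * N < η := by
    have : e * N = η / 2 := by rw [he]; field_simp
    linarith
  filter_upwards [hlim.eventually_lt_const hlt, eventually_ge_atTop 1] with m hm1 hm2 t ht
  exact (abs_discrepancy_le τ j he0.le hm2 hC ht).trans hm1.le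

/-! ### The law of large numbers for each vortex -/

/-- The strong law of large numbers along an arithmetic progression. -/
lemma ae_tendsto_average_progression {Ω : Type*} [MeasurableSpace Ω] {P : Measure Ω}
    {τ : ℕ → Ω → ℝ} (hindep : iIndepFun τ P)
    (hident : ∀ i, IdentDistrib (τ i) (τ 0) P P) (hint : Integrable (τ 0) P)
    (a : ℕ) {b : ℕ} (hb : 0 < b) :
    ∀ᵐ ω ∂P, Tendsto (fun n : ℕ => (∑ k ∈ Finset.range n, τ (a + b * k) ω) / n) atTop
      (𝓝 (∫ ω, τ 0 ω ∂P)) := by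
  have h := strong_law_ae_real (fun k => τ (a + b * k)) ((hident _).integrable_iff.2 hint)
    (fun k l hkl => hindep.indepFun fun h => hkl (by
      exact Nat.eq_of_mul_eq_mul_left hb (Nat.add_left_cancel h)))
    (fun k => (hident _).trans (hident _).symm)
  rw [(hident (a + b * 0)).integral_eq] at h
  exact h

/-! ### Trajectories and flows on the torus, and convergence -/

/-- The covering map `(ℝ²)^N → 𝕋^N`. -/
def project {N : ℕ} (X : Fin N → Plane) : Config N := fun i => toTorus (X i)

lemma continuous_project {N : ℕ} : Continuous (project (N := N)) :=
  continuous_pi fun i => continuous_toTorus.comp (continuous_apply i)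

lemma project_surjective {N : ℕ} : Function.Surjective (project (N := N)) :=
  toTorus_surjective.comp_left

lemma project_sub {N : ℕ} (X Y : Fin N → Plane) : project (X - Y) = project X - project Y :=
  funext fun _ => toTorus_sub _ _

section Trajectories

variable {N : ℕ} {κ : Torus → Plane} {ξ : Fin N → ℝ}

lemma splitField_congr {X Y : Fin N → Plane} (h : project X = project Y) (i : Fin N) :
    splitField κ ξ i X = splitField κ ξ i Y := by
  have : (fun j => toTorus (X j)) = fun j => toTorus (Y j) := h
  simp only [splitField, liftVelocity, this]

/-- Uniqueness, on the torus, for lifted trajectories of a periodic vector field. -/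
lemma project_eq_of_hasDerivWithinAt {V : ℝ → (Fin N → Plane) → (Fin N → Plane)}
    (hper : ∀ t X Y, project X = project Y → V t X = V t Y)
    (hlip : ∀ T, ∃ K : ℝ≥0, ∀ t ∈ Ico 0 T, LipschitzWith K (V t))
    {X Y : ℝ → Fin N → Plane} (h0 : project (X 0) = project (Y 0))
    (hXc : ContinuousOn X (Ici 0)) (hYc : ContinuousOn Y (Ici 0))
    (hX : ∀ t, 0 ≤ t → HasDerivWithinAt X (V t (X t)) (Ici t) t)
    (hY : ∀ t, 0 ≤ t → HasDerivWithinAt Y (V t (Y t)) (Ici t) t) {t : ℝ} (ht : 0 ≤ t) :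
    project (X t) = project (Y t) := by
  obtain ⟨K, hK⟩ := hlip t
  -- The lifts start a lattice vector apart; by periodicity, subtracting it gives a solution with
  -- the initial value of `Y`.
  have hshift : ∀ s, project (X s - (X 0 - Y 0)) = project (X s) := fun s => by
    rw [project_sub, project_sub, h0, sub_self, sub_zero]
  have heq := ODE_solution_unique_of_mem_Icc_right (v := V) (s := fun _ => univ) (K := K)
    (f := fun s => X s - (X 0 - Y 0)) (g := Y) (a := 0) (b := t)
    (fun s hs => (hK s hs).lipschitzOnWith)
    ((hXc.mono Icc_subset_Ici_self).sub continuousOn_const)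
    (fun s hs => by
      rw [hper s _ _ (hshift s)]
      exact (hX s hs.1).sub_const _)
    (fun _ _ => trivial) (hYc.mono Icc_subset_Ici_self) (fun s hs => hY s hs.1)
    (fun _ _ => trivial) (sub_sub_cancel _ _) (right_mem_Icc.2 ht)
  rw [← hshift, ← heq]

lemma exists_lift_vortexTrajectory (hκ : ContDiff ℝ 1 fun p => κ (toTorus p))
    (x : Fin N → Plane) : ∃ Y : ℝ → Fin N → Plane, Y 0 = x ∧
      ∀ t, HasDerivAt Y (∑ j, splitField κ ξ j (Y t)) t := by
  obtain ⟨M, L, h⟩ := exists_bound_and_lipschitz_splitField ξ hκ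
  refine exists_global_solution (F := fun X => ∑ j, splitField κ ξ j X) (M := ∑ _j : Fin N, M)
    (L := ∑ _j : Fin N, L) (fun X => ?_) ?_ x
  · push_cast
    exact norm_sum_le_of_le _ fun j _ => (h j).1 X
  · refine LipschitzWith.of_dist_le_mul fun X Y => ?_
    push_cast
    rw [Finset.sum_mul]
    exact dist_sum_sum_le_of_le _ fun j _ => (h j).2.dist_le_mul _ _

lemma isVortexTrajectory_project {Y : ℝ → Fin N → Plane}
    (hY : ∀ t, HasDerivAt Y (∑ j, splitField κ ξ j (Y t)) t) :
    IsVortexTrajectory κ ξ (project (Y 0)) fun t => project (Y t) := by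
  refine ⟨rfl, Y, fun _ _ _ => rfl, fun t _ => ?_⟩
  have := (hY t).hasDerivWithinAt (s := Ici 0)
  rwa [sum_splitField] at this

lemma IsVortexTrajectory.eq (hκ : ContDiff ℝ 1 fun p => κ (toTorus p)) {y : Config N}
    {γ γ' : ℝ → Config N} (h : IsVortexTrajectory κ ξ y γ) (h' : IsVortexTrajectory κ ξ y γ')
    {t : ℝ} (ht : 0 ≤ t) : γ t = γ' t := by
  obtain ⟨h0, X, hX, hXd⟩ := h
  obtain ⟨h0', X', hX', hXd'⟩ := h'
  obtain ⟨M, L, hML⟩ := exists_bound_and_lipschitz_splitField ξ hκ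
  have hγ : ∀ t, 0 ≤ t → γ t = project (X t) := fun t ht => funext (hX t ht)
  have hγ' : ∀ t, 0 ≤ t → γ' t = project (X' t) := fun t ht => funext (hX' t ht)
  rw [hγ t ht, hγ' t ht]
  refine project_eq_of_hasDerivWithinAt (V := fun _ X => ∑ j, splitField κ ξ j X)
    (fun _ X Y hXY => Finset.sum_congr rfl fun j _ => splitField_congr hXY j)
    (fun _ => ⟨∑ _j : Fin N, L, fun _ _ => LipschitzWith.of_dist_le_mul fun X Y => ?_⟩)
    (by rw [← hγ 0 le_rfl, ← hγ' 0 le_rfl, h0, h0'])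
    (fun t ht => (hXd t ht).continuousWithinAt) (fun t ht => (hXd' t ht).continuousWithinAt)
    (fun t ht => ?_) (fun t ht => ?_) ht
  · push_cast
    rw [Finset.sum_mul]
    exact dist_sum_sum_le_of_le _ fun j _ => (hML j).2.dist_le_mul _ _
  · rw [sum_splitField]
    refine ((hXd t ht).mono (Ici_subset_Ici.2 ht)).congr_deriv ?_
    rw [hγ t ht]; rfl
  · rw [sum_splitField]
    refine ((hXd' t ht).mono (Ici_subset_Ici.2 ht)).congr_deriv ?_
    rw [hγ' t ht]; rfl

lemma exists_isVortexFlow (hκ : ContDiff ℝ 1 fun p => κ (toTorus p)) :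
    ∃ Φ, IsVortexFlow κ ξ Φ := by
  have h : ∀ y, ∃ γ, IsVortexTrajectory κ ξ y γ := fun y => by
    obtain ⟨x, rfl⟩ := project_surjective y
    obtain ⟨Y, rfl, hY⟩ := exists_lift_vortexTrajectory (ξ := ξ) hκ x
    exact ⟨_, isVortexTrajectory_project hY⟩
  choose γ hγ using h
  exact ⟨fun t y => γ y t, fun y => ⟨hγ y, fun γ' hγ' t ht => hγ'.eq hκ (hγ y) ht⟩⟩

variable [NeZero N] {m : ℕ} {τ : ℕ → ℝ}

lemma splitVelocity_project (t : ℝ) (X : Fin N → Plane) :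
    splitVelocity κ ξ m τ t (project X) = ((N : ℝ) * τ ⌊(N : ℝ) * m * t⌋₊) •
      splitField κ ξ (Fin.ofNat N ⌊(N : ℝ) * m * t⌋₊) X := by
  rw [splitVelocity, splitField, ← Pi.single_smul]
  rfl

lemma exists_lift_splitTrajectory (hκ : ContDiff ℝ 1 fun p => κ (toTorus p)) (hm : 1 ≤ m)
    (τ : ℕ → ℝ) (x : Fin N → Plane) : ∃ X : ℝ → Fin N → Plane, X 0 = x ∧ ContinuousOn X (Ici 0) ∧
      ∀ t, 0 ≤ t → HasDerivWithinAt X (((N : ℝ) * τ ⌊(N : ℝ) * m * t⌋₊) •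
        splitField κ ξ (Fin.ofNat N ⌊(N : ℝ) * m * t⌋₊) (X t)) (Ici t) t := by
  obtain ⟨M, L, hML⟩ := exists_bound_and_lipschitz_splitField ξ hκ
  obtain ⟨X, h0, hc, hd⟩ := exists_switched_solution
    -- Running at speed `N m` multiplies this by `N m`, leaving intensity `N τ n`.
    (F := fun n X => (τ n / m) • splitField κ ξ (Fin.ofNat N n) X)
    (M := fun n => ‖τ n / m‖₊ * M) (L := fun n => ‖τ n / m‖₊ * L)
    (fun n X => by
      rw [norm_smul]; push_cast; gcongr; exact (hML _).1 X)
    (fun n => (lipschitzWith_smul (τ n / (m : ℝ))).comp (hML _).2) (speed_pos N hm) x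
  refine ⟨X, h0, hc, fun t ht => (hd t ht).congr_deriv ?_⟩
  have : (m : ℝ) ≠ 0 := by positivity
  rw [smul_smul]
  congr 1
  field_simp

lemma isSplitTrajectory_project {X : ℝ → Fin N → Plane} (hc : ContinuousOn X (Ici 0))
    (hX : ∀ t, 0 ≤ t → HasDerivWithinAt X (((N : ℝ) * τ ⌊(N : ℝ) * m * t⌋₊) •
        splitField κ ξ (Fin.ofNat N ⌊(N : ℝ) * m * t⌋₊) (X t)) (Ici t) t) :
    IsSplitTrajectory κ ξ m τ (project (X 0)) fun t => project (X t) :=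
  ⟨rfl, X, fun _ _ _ => rfl, hc, fun t ht => by rw [splitVelocity_project]; exact hX t ht⟩

lemma IsSplitTrajectory.eq (hκ : ContDiff ℝ 1 fun p => κ (toTorus p)) {y : Config N}
    {γ γ' : ℝ → Config N} (h : IsSplitTrajectory κ ξ m τ y γ)
    (h' : IsSplitTrajectory κ ξ m τ y γ') {t : ℝ} (ht : 0 ≤ t) : γ t = γ' t := by
  obtain ⟨h0, X, hX, hXc, hXd⟩ := h
  obtain ⟨h0', X', hX', hXc', hXd'⟩ := h'
  obtain ⟨M, L, hML⟩ := exists_bound_and_lipschitz_splitField ξ hκ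
  have hγ : ∀ t, 0 ≤ t → γ t = project (X t) := fun t ht => funext (hX t ht)
  have hγ' : ∀ t, 0 ≤ t → γ' t = project (X' t) := fun t ht => funext (hX' t ht)
  rw [hγ t ht, hγ' t ht]
  refine project_eq_of_hasDerivWithinAt (V := fun t X => splitVelocity κ ξ m τ t (project X))
    (fun _ X Y hXY => by simp only [hXY])
    -- Only finitely many intensities occur before time `T`; their sum dominates each.
    (fun T => ⟨(∑ n ∈ Finset.range (⌊(N : ℝ) * m * T⌋₊ + 1), ‖(N : ℝ) * τ n‖₊) * L,
      fun t ht => ?_⟩)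
    (by rw [← hγ 0 le_rfl, ← hγ' 0 le_rfl, h0, h0']) hXc hXc'
    (fun t ht => by rw [← hγ t ht]; exact hXd t ht)
    (fun t ht => by rw [← hγ' t ht]; exact hXd' t ht) ht
  simp only [splitVelocity_project]
  refine ((lipschitzWith_smul _).comp (hML _).2).weaken ?_
  gcongr
  refine Finset.single_le_sum (f := fun n => ‖(N : ℝ) * τ n‖₊) (fun _ _ => zero_le)
    (Finset.mem_range.2 (Nat.lt_succ_of_le (Nat.floor_mono ?_)))
  gcongr
  exact ht.2.le

lemma exists_isSplitFlow (hκ : ContDiff ℝ 1 fun p => κ (toTorus p)) (hm : 1 ≤ m) (τ : ℕ → ℝ) :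
    ∃ Ψ, IsSplitFlow κ ξ m τ Ψ := by
  have h : ∀ y, ∃ γ, IsSplitTrajectory κ ξ m τ y γ := fun y => by
    obtain ⟨x, rfl⟩ := project_surjective y
    obtain ⟨X, rfl, hXc, hX⟩ := exists_lift_splitTrajectory (ξ := ξ) hκ hm τ x
    exact ⟨_, isSplitTrajectory_project hXc hX⟩
  choose γ hγ using h
  exact ⟨fun t y => γ y t, fun y => ⟨hγ y, fun γ' hγ' t ht => hγ'.eq hκ (hγ y) ht⟩⟩

/-- Convergence of the split flows for a fixed sequence of non-negative times that satisfies the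
law of large numbers along the steps of each vortex. -/
lemma tendsto_splitFlow (hκ : ContDiff ℝ 1 fun p => κ (toTorus p)) (hτ : ∀ n, 0 ≤ τ n)
    (hlln : ∀ j : Fin N,
      Tendsto (fun n : ℕ => (∑ k ∈ Finset.range n, τ (j + N * k)) / n) atTop (𝓝 1))
    {Φ : ℝ → Config N → Config N} (hΦ : IsVortexFlow κ ξ Φ)
    {Ψ : ℕ → ℝ → Config N → Config N} (hΨ : ∀ m, 1 ≤ m → IsSplitFlow κ ξ m τ (Ψ m))
    (y : Config N) {t : ℝ} (ht : t ∈ Icc (0 : ℝ) 1) :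
    Tendsto (fun m => Ψ m t y) atTop (𝓝 (Φ t y)) := by
  obtain ⟨M, L, hML⟩ := exists_bound_and_lipschitz_splitField ξ hκ
  obtain ⟨x, rfl⟩ := project_surjective y
  obtain ⟨Y, hY0, hY⟩ := exists_lift_vortexTrajectory (ξ := ξ) hκ x
  have hX : ∀ m : ℕ, ∃ X : ℝ → Fin N → Plane, 1 ≤ m → X 0 = x ∧ ContinuousOn X (Ici 0) ∧
      ∀ t, 0 ≤ t → HasDerivWithinAt X (((N : ℝ) * τ ⌊(N : ℝ) * m * t⌋₊) •
        splitField κ ξ (Fin.ofNat N ⌊(N : ℝ) * m * t⌋₊) (X t)) (Ici t) t := fun m => by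
    by_cases hm : 1 ≤ m
    · obtain ⟨X, h⟩ := exists_lift_splitTrajectory (ξ := ξ) hκ hm τ x
      exact ⟨X, fun _ => h⟩
    · exact ⟨0, fun h => absurd h hm⟩
  choose X hX using hX
  have hΦY : Φ t (project x) = project (Y t) := by
    subst hY0
    exact ((hΦ _).2 _ (isVortexTrajectory_project hY) t ht.1).symm
  have hΨX : ∀ᶠ m in atTop, project (X m t) = Ψ m t (project x) := by
    filter_upwards [eventually_ge_atTop 1] with m hm
    obtain ⟨h0, hc, hd⟩ := hX m hm
    have := (hΨ m hm _).2 _ (isSplitTrajectory_project hc hd) t ht.1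
    rwa [h0] at this
  rw [hΦY]
  refine Tendsto.congr' hΨX ((continuous_project.tendsto _).comp ?_)
  let b : ℝ → ℝ := fun η => N * M * η +
    (N * M + N * L * (N * M) + 1) * η * Real.exp (2 * L * (N + 2 * N * η) + 1)
  have hb : Tendsto b (𝓝[>] 0) (𝓝 0) := by
    have : Continuous b := by fun_prop
    have h := this.tendsto 0
    simp only [b, mul_zero, zero_mul, add_zero] at h
    exact h.mono_left nhdsWithin_le_nhds
  rw [Metric.tendsto_nhds]
  intro e he
  -- First `η` is fixed from the averaging bound, then `m` is taken large enough to bring all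
  -- discrepancies below it.
  obtain ⟨η, hbη, hη⟩ := ((hb.eventually_lt_const he).and self_mem_nhdsWithin).exists
  filter_upwards [eventually_abs_discrepancy_le hlln hη, eventually_ge_atTop 1] with m hD hm
  obtain ⟨h0, hc, hd⟩ := hX m hm
  rw [dist_eq_norm]
  refine lt_of_le_of_lt ?_ hbη
  exact norm_sub_le_of_intensities (F := splitField κ ξ) (fun i => (hML i).1) (fun i => (hML i).2)
    (fun i => differentiable_splitField ξ hκ i) (a := fun t => (N : ℝ) * τ ⌊(N : ℝ) * m * t⌋₊)
    (σ := fun t => Fin.ofNat N ⌊(N : ℝ) * m * t⌋₊) (D := discrepancy τ m) hη (h0.trans hY0.symm)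
    (fun t => mul_nonneg N.cast_nonneg (hτ _)) (hc.mono Icc_subset_Ici_self)
    (fun s _ => (hY s).continuousAt.continuousWithinAt) (fun s hs => hd s hs.1)
    (fun s _ => (hY s).hasDerivWithinAt) (fun j => discrepancy_zero τ j m)
    (fun j => (continuousOn_discrepancy τ j hm).mono Icc_subset_Ici_self)
    (fun j s hs => hasDerivWithinAt_discrepancy τ j hm hs.1) hD ht

end Trajectories

end

end PointVortex

theorem proposition2p2 {N : ℕ} [NeZero N] (ξ : Fin N → ℝ) (hξ : ∀ i, ξ i ≠ 0)
    (δ : ℝ) (hδ : 0 < δ) (χ : PointVortex.Torus → ℝ)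
    (hχ_smooth : ContDiff ℝ ((⊤ : ℕ∞) : WithTop ℕ∞) (fun p : PointVortex.Plane => χ (PointVortex.toTorus p)))
    (hχ_supp : ∀ y, χ y ≠ 0 → PointVortex.torusNorm y ≤ δ)
    (hχ_zero : χ 0 = 1)
    (hK_zero : ContDiffAt ℝ ((⊤ : ℕ∞) : WithTop ℕ∞)
      (fun p : PointVortex.Plane => PointVortex.cutoffKernel χ (PointVortex.toTorus p)) 0)
    {Ω : Type*} [MeasurableSpace Ω] (P : Measure Ω) [IsProbabilityMeasure P]
    (τ : ℕ → Ω → ℝ) (hτ_meas : ∀ i, Measurable (τ i)) (hτ_indep : iIndepFun τ P)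
    (hτ_ident : ∀ i, IdentDistrib (τ i) (τ 0) P P)
    (hτ_nonneg : ∀ i, ∀ᵐ ω ∂P, 0 ≤ τ i ω)
    (hτ_tail : ∃ C c : ℝ, 0 < c ∧ ∀ r : ℝ, 0 ≤ r →
      P.real {ω | r < τ 0 ω} ≤ C * Real.exp (-c * r))
    (hτ_mean : ∫ ω, τ 0 ω ∂P = 1)
    (x : PointVortex.Config N) (hx : ∀ i j, i ≠ j → x i ≠ x j) :
    ∃ (Φ : ℝ → PointVortex.Config N → PointVortex.Config N)
      (Ψ : ℕ → Ω → ℝ → PointVortex.Config N → PointVortex.Config N),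
      PointVortex.IsVortexFlow (PointVortex.cutoffKernel χ) ξ Φ ∧
      (∀ m : ℕ, 1 ≤ m → ∀ ω : Ω,
        PointVortex.IsSplitFlow (PointVortex.cutoffKernel χ) ξ m (fun i => τ i ω) (Ψ m ω)) ∧
      ∀ᵐ ω ∂P, ∀ t ∈ Icc (0 : ℝ) 1,
        Tendsto (fun m : ℕ => Ψ m ω t x) atTop (𝓝 (Φ t x)) := by
  have hκ : ContDiff ℝ 1 fun p : PointVortex.Plane =>
      PointVortex.cutoffKernel χ (PointVortex.toTorus p) :=
    PointVortex.contDiff_cutoffKernel (hχ_smooth.of_le (by norm_cast))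
      (hK_zero.of_le (by norm_cast))
  obtain ⟨Φ, hΦ⟩ := PointVortex.exists_isVortexFlow (ξ := ξ) hκ
  have hsplit : ∀ (m : ℕ) (ω : Ω), ∃ Ψ : ℝ → PointVortex.Config N → PointVortex.Config N,
      1 ≤ m → PointVortex.IsSplitFlow (PointVortex.cutoffKernel χ) ξ m (fun i => τ i ω) Ψ := by
    intro m ω
    by_cases hm : 1 ≤ m
    · obtain ⟨Ψ, hΨ⟩ := PointVortex.exists_isSplitFlow (ξ := ξ) hκ hm fun i => τ i ω
      exact ⟨Ψ, fun _ => hΨ⟩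
    · exact ⟨Φ, fun h => absurd h hm⟩
  choose Ψ hΨ using hsplit
  -- A non-integrable function has integral `0` by convention, so mean `1` forces integrability.
  have hint : Integrable (τ 0) P := by
    by_contra h
    rw [integral_undef h] at hτ_mean
    exact zero_ne_one hτ_mean
  have hlln : ∀ᵐ ω ∂P, ∀ j : Fin N, Tendsto
      (fun n : ℕ => (∑ k ∈ Finset.range n, τ (j + N * k) ω) / n) atTop (𝓝 1) := by
    rw [ae_all_iff]
    intro j
    rw [← hτ_mean]
    exact PointVortex.ae_tendsto_average_progression hτ_indep hτ_ident hint j (NeZero.pos N)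
  refine ⟨Φ, Ψ, hΦ, fun m hm ω => hΨ m ω hm, ?_⟩
  -- From here on the argument is deterministic; nonnegative times are what the averaging estimate
  -- needs of its intensity.
  filter_upwards [ae_all_iff.2 hτ_nonneg, hlln] with ω hnonneg hω t ht
  exact PointVortex.tendsto_splitFlow hκ hnonneg hω hΦ (fun m hm => hΨ m ω hm) x ht
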